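/- Let $0<q<1$ and $q<a<1/q$. Write $(z;q)_n=\prod_{k=0}^{n-1}(1-zq^k)$, $(z;q)_\infty=\prod_{k\ge0}(1-zq^k)$ and $(z_1,\dots,z_r;q)_\infty=\prod_i(z_i;q)_\infty$. Let $V_n=V_n^{(a)}(x;q)$ be the Al-Salam–Carlitz polynomials, i.e. $V_{-1}=0$, $V_0=1$, $V_{n+1}=(x-(1+a)q^{-n})V_n-aq^{1-2n}(1-q^n)V_{n-1}$. There is a probability measure on $\mathbb R$ with finite moments of all orders for which the $V_n$ are pairwise orthogonal and which has orthonormal polynomials $(p_n)$ ($p_n$ of degree $n$ with positive leading coefficient). Moreover: (i) For every such measure and its orthonormal polynomials $p_n$, the series $\sum_k|p_k(e^{i\theta})|^2$ converges for every real $\theta$, its sum is integrable over $[0,2\pi]$, and $$\rho_0:=\int_0^{2\pi}\sum_{k=0}^\infty|p_k(e^{i\theta})|^2\,\frac{d\theta}{2\pi}=\frac1{(aq,q,q;q)_\infty}\sum_{n=0}^\infty I_n\,\frac{(aq;q)_n}{(q;q)_n}\Bigl(\frac qa\Bigr)^n,$$ where the series on the right converges and, for $n\ge0$ (the integrals existing),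 $$I_n=\int_0^{2\pi}\frac{(e^{i\theta},e^{-i\theta};q)_\infty}{(1-q^ne^{i\theta})(1-q^ne^{-i\theta})}\,\frac{d\theta}{2\pi}=\oint_{|z|=1}\frac{(z,1/z;q)_\infty}{(1-q^nz)(1-q^n/z)}\,\frac{dz}{2\pi iz}.$$ (ii) For all complex $z\ne0$, $(q,z,1/z;q)_\infty=\sum_{k\in\mathbb Z}c_kz^k$ with $c_k=(-1)^k\bigl[q^{k(k+1)/2}+q^{k(k-1)/2}\bigr]$, and $c_k=c_{-k}$. (iii) $$I_0=\frac1{(q;q)_\infty}\sum_{k=0}^\infty(-1)^kq^{k(k+1)/2},\qquad I_n=\frac1{(1-q^{2n})(q;q)_\infty}\sum_{k=1}^\infty c_k\,(q^{nk}-q^{-nk})\quad(n\ge1).$$ (iv) For every integer $n$, $\sum_{k\in\mathbb Z}(-1)^kq^{nk}q^{k(k-1)/2}=0$, and $$\sum_{k=0}^\infty(-1)^kq^{nk}q^{\binom k2}=-\sum_{k=1}^\infty(-1)^kq^{-nk}q^{\binom{k+1}2}.$$ (v) For every integer $n\ge0$, $$(q;q)_\infty(1-q^{2n})\,I_n=2\sum_{k=1}^\infty(-1)^kq^{\binom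 k2}\bigl[q^{nk}-q^{-nk}\bigr].$$ (vi) For every $n\ge1$ and every complex $\tau$ with $q=e^{-i\tau}$ one has $\sin(n\tau)\ne0$ and $$I_n=\frac{2q^{-n}}{(q;q)_\infty}\sum_{k=1}^\infty(-1)^{k-1}q^{\binom k2}\,\frac{\sin(nk\tau)}{\sin(n\tau)}.$$ All series in (ii)–(vi) converge absolutely. -/

import Mathlib

open MeasureTheory Polynomial

/-- The finite `q`-shifted factorial `(z; q)_n`. -/
noncomputable def qPoch (z q : ℂ) (n : ℕ) : ℂ := ∏ k ∈ Finset.range n, (1 - z * q ^ k)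

/-- The infinite `q`-shifted factorial `(z; q)_∞` (convergent for `‖q‖ < 1`). -/
noncomputable def qPochInf (z q : ℂ) : ℂ := ∏' k : ℕ, (1 - z * q ^ k)

/-- The monic Al-Salam--Carlitz polynomials `V_n^{(a)}(x; q)`, given by
`V_{n+1} = (x - (1 + a) q^{-n}) V_n - a q^{1-2n} (1 - q^n) V_{n-1}`, `V_0 = 1`, `V_{-1} = 0`. -/
noncomputable def alSalamCarlitzV (a q : ℝ) : ℕ → ℝ[X]
  | 0 => 1
  | 1 => X - C (1 + a)
  | n + 2 => (X - C ((1 + a) * (q ^ (n + 1))⁻¹)) * alSalamCarlitzV a q (n + 1)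
      - C (a * (q ^ (2 * n + 1))⁻¹ * (1 - q ^ (n + 1))) * alSalamCarlitzV a q n

/-- `μ` has finite moments of all orders, and `p` is the sequence of its orthonormal polynomials:
`p n` has degree `n` and positive leading coefficient, and `∫ p_m p_n dμ = δ_{m n}`. -/
structure IsOrthonormalPolynomials (μ : Measure ℝ) (p : ℕ → ℝ[X]) : Prop where
  integrable_pow : ∀ n : ℕ, Integrable (fun x : ℝ => x ^ n) μ
  natDegree_eq : ∀ n, (p n).natDegree = n
  leadingCoeff_pos : ∀ n, 0 < (p n).leadingCoeff
  integral_mul : ∀ m n, ∫ x, (p m).eval x * (p n).eval x ∂μ = if m = n then 1 else 0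

/-- `μ` is a probability measure for which the polynomials `V_n^{(a)}(x; q)` are pairwise
orthogonal, and `p` is the corresponding sequence of orthonormal polynomials. -/
structure IsAlSalamCarlitzSystem (a q : ℝ) (μ : Measure ℝ) (p : ℕ → ℝ[X]) : Prop where
  isProbabilityMeasure : IsProbabilityMeasure μ
  orthonormal : IsOrthonormalPolynomials μ p
  orthogonal : ∀ m n, m ≠ n →
    ∫ x, (alSalamCarlitzV a q m).eval x * (alSalamCarlitzV a q n).eval x ∂μ = 0

/-- The point `e^{iθ}` of the unit circle. -/
noncomputable def circlePt (θ : ℝ) : ℂ := Complex.exp (θ * Complex.I)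

/-- `ρ₀ = ∫_0^{2π} ∑_k |p_k(e^{iθ})|² dθ / 2π`. -/
noncomputable def rhoZero (p : ℕ → ℝ[X]) : ℝ :=
  (∫ θ in (0 : ℝ)..(2 * Real.pi), ∑' k : ℕ, ‖aeval (circlePt θ) (p k)‖ ^ 2) / (2 * Real.pi)

/-- The function `(z, 1/z; q)_∞ / ((1 - q^n z)(1 - q^n / z))`. -/
noncomputable def thetaKernel (q : ℝ) (n : ℕ) (z : ℂ) : ℂ :=
  qPochInf z q * qPochInf (1 / z) q / ((1 - (q : ℂ) ^ n * z) * (1 - (q : ℂ) ^ n / z))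

/-- `I_n`, the mean over the unit circle of `(z, 1/z; q)_∞ / ((1 - q^n z)(1 - q^n / z))`. -/
noncomputable def thetaIntegral (q : ℝ) (n : ℕ) : ℂ :=
  (∫ θ in (0 : ℝ)..(2 * Real.pi), thetaKernel q n (circlePt θ)) / (2 * Real.pi)

/-- `c_k = (-1)^k (q^{k(k+1)/2} + q^{k(k-1)/2})` for integers `k` (the divisions are exact). -/
noncomputable def thetaCoeff (q : ℝ) (k : ℤ) : ℂ :=
  (-1) ^ k * ((q : ℂ) ^ (k * (k + 1) / 2) + (q : ℂ) ^ (k * (k - 1) / 2))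

/-!
Write `x_m = q^{-m}`. For `0 < aq < 1` the masses proportional to
`q^{m²} a^m / ((q;q)_m (aq;q)_m)` at the points `x_m` form a probability measure for which the
`V_n` are orthogonal: Cauchy's identity `∑ q^{s²} b^s / ((q;q)_s (bq;q)_s) = 1 / (bq;q)_∞`
evaluates the functional on the basis `(x;q)_j` (`massSum_qFac`), and the three-term recurrence
then gives a product formula for the mixed moments of `(x;q)_j` and `V_n`, which vanishes for
`j < n` (`massSum_qFac_mul_V`). Any other orthogonality measure has the same moments, so that its
orthonormal polynomials `p_k` are orthonormal for the discrete measure as well.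

For `a > q` the sum `∑ |p_k(x)|²` is finite at every point, and it is computed by Parseval's
identity in `ℓ²` of the discrete measure. Every polynomial is the sum of its Lagrange interpolation
series at the nodes `x_m` (`hasSum_eval_mul_lagrangeFun`), hence `p_k(x)` is the `k`-th Fourier
coefficient of the vector with the entries `ℓ_m(x) / mass_m`, where `ℓ_m` are the interpolation
functions, and `∑ |p_k(x)|² = ∑ |ℓ_m(x)|² / mass_m` once the polynomials are complete. Completeness
(`eq_zero_of_inner_polyVec_eq_zero`) rests on `V_n(1) = (-a)^n q^{-n(n-1)/2}`: by Euler's identity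
Bessel's inequality at the point mass at `1` is an equality. So a vector orthogonal to all
polynomials vanishes at `1`; its quotients by powers of `x - 1` are then orthogonal to all
polynomials too, and letting the power grow isolates one node after the other. As `ℓ_m(x)` is, up to
a constant, `(x;q)_∞ / (1 - x q^m)`, integration over the unit circle produces the integrals `I_m`.

The integrals are evaluated with the Jacobi triple product, obtained from the `q`-binomial theorem
by dominated convergence. For `n ≥ 1` the factor `1 / ((1 - q^n z)(1 - q^n / z))` is a multiple of
the Poisson kernel `∑ q^{n|j|} z^j`; for `n = 0` the theta series is divided by `1 - z` term by term.
The remaining identities express that the theta function vanishes at the powers of `q`.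
-/

open Filter Topology

/-! ### The `q`-shifted factorials -/

/-- The finite `q`-shifted factorial over an arbitrary commutative ring; over `ℂ` it is `qPoch`. -/
def qFac {R : Type*} [CommRing R] (z q : R) (n : ℕ) : R := ∏ k ∈ Finset.range n, (1 - z * q ^ k)

section Algebra
variable {R : Type*} [CommRing R] (z q : R)

lemma qPoch_eq_qFac (z q : ℂ) (n : ℕ) : qPoch z q n = qFac z q n := rfl

@[simp] lemma qFac_zero : qFac z q 0 = 1 := by simp [qFac]

lemma qFac_succ (n : ℕ) : qFac z q (n + 1) = qFac z q n * (1 - z * q ^ n) := by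
  simp [qFac, Finset.prod_range_succ]

lemma qFac_succ' (n : ℕ) : qFac z q (n + 1) = (1 - z) * qFac (z * q) q n := by
  simp only [qFac, Finset.prod_range_succ', pow_zero, mul_one, pow_succ', mul_assoc]
  exact mul_comm _ _

lemma qFac_add (m n : ℕ) : qFac z q (m + n) = qFac z q m * qFac (z * q ^ m) q n := by
  simp [qFac, Finset.prod_range_add, pow_add, mul_assoc]

end Algebra

lemma ofReal_qFac (z q : ℝ) (n : ℕ) : ((qFac z q n : ℝ) : ℂ) = qFac (z : ℂ) q n := by
  simp [qFac]

section Real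
variable {z q : ℝ}

lemma mul_pow_lt_one (hq0 : 0 < q) (hq1 : q < 1) (hz1 : z < 1) (n : ℕ) : z * q ^ n < 1 := by
  have h1 : q ^ n ≤ 1 := pow_le_one₀ hq0.le hq1.le
  have h2 : 0 < q ^ n := pow_pos hq0 n
  nlinarith [mul_lt_mul_of_pos_right hz1 h2]

lemma qFac_pos (hq0 : 0 < q) (hq1 : q < 1) (hz1 : z < 1) (n : ℕ) : 0 < qFac z q n :=
  Finset.prod_pos fun k _ => sub_pos.2 (mul_pow_lt_one hq0 hq1 hz1 k)

end Real

section Infinite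
variable {q : ℂ}

lemma summable_norm_mul_pow (hq : ‖q‖ < 1) (z : ℂ) : Summable fun k : ℕ => ‖-(z * q ^ k)‖ := by
  simpa using (summable_geometric_of_lt_one (norm_nonneg q) hq).mul_left ‖z‖

lemma tendsto_qFac (hq : ‖q‖ < 1) (z : ℂ) :
    Tendsto (fun n => qFac z q n) atTop (𝓝 (qPochInf z q)) := by
  have h : Multipliable fun k : ℕ => 1 - z * q ^ k := by
    simpa [sub_eq_add_neg] using multipliable_one_add_of_summable (summable_norm_mul_pow hq z)
  exact h.tendsto_prod_tprod_nat

lemma qPochInf_split (hq : ‖q‖ < 1) (z : ℂ) (m : ℕ) :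
    qPochInf z q = qFac z q m * qPochInf (z * q ^ m) q := by
  refine tendsto_nhds_unique ((tendsto_add_atTop_iff_nat m).2 (tendsto_qFac hq z)) ?_
  simp_rw [add_comm _ m, qFac_add]
  exact (tendsto_qFac hq _).const_mul _

lemma qPochInf_eq_zero (hq : ‖q‖ < 1) (z : ℂ) (m : ℕ) (h : z * q ^ m = 1) :
    qPochInf z q = 0 := by
  rw [qPochInf_split hq z (m + 1), qFac_succ, h]; simp

/-- A bound for the finite `q`-shifted factorials that is uniform in their length. -/
lemma norm_qFac_le (hq : ‖q‖ < 1) (z : ℂ) (n : ℕ) :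
    ‖qFac z q n‖ ≤ Real.exp (‖z‖ * (1 - ‖q‖)⁻¹) := by
  calc ‖qFac z q n‖ ≤ ∏ k ∈ Finset.range n, Real.exp (‖z‖ * ‖q‖ ^ k) := by
        refine (Finset.norm_prod_le _ _).trans (Finset.prod_le_prod (fun _ _ => norm_nonneg _) ?_)
        intro k _
        calc ‖1 - z * q ^ k‖ ≤ ‖z‖ * ‖q‖ ^ k + 1 := by
              refine (norm_sub_le _ _).trans (le_of_eq ?_); simp [add_comm]
          _ ≤ _ := Real.add_one_le_exp _
    _ = Real.exp (∑ k ∈ Finset.range n, ‖z‖ * ‖q‖ ^ k) := (Real.exp_sum _ _).symm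
    _ ≤ _ := by
        rw [Real.exp_le_exp, ← tsum_geometric_of_lt_one (norm_nonneg q) hq, ← tsum_mul_left]
        exact ((summable_geometric_of_lt_one (norm_nonneg q) hq).mul_left _).sum_le_tsum _
          fun _ _ => by positivity

lemma continuous_qPochInf (hq : ‖q‖ < 1) : Continuous fun z => qPochInf z q := by
  refine continuous_iff_continuousAt.2 fun z₀ => ?_
  have hu : Summable fun k : ℕ => (‖z₀‖ + 1) * ‖q‖ ^ k :=
    (summable_geometric_of_lt_one (norm_nonneg q) hq).mul_left _
  have h := Summable.hasProdLocallyUniformlyOn_nat_one_add (f := fun (k : ℕ) (z : ℂ) => -(z * q ^ k))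
    (K := Metric.ball 0 (‖z₀‖ + 1)) Metric.isOpen_ball hu
    (Eventually.of_forall fun n z hz => by
      have hz' : ‖z‖ ≤ ‖z₀‖ + 1 := by simpa using (mem_ball_zero_iff.1 hz).le
      simpa using mul_le_mul_of_nonneg_right hz' (by positivity))
    (fun n => by fun_prop)
  have hc : ContinuousOn (fun z => ∏' k : ℕ, (1 + -(z * q ^ k))) (Metric.ball 0 (‖z₀‖ + 1)) :=
    h.tendstoLocallyUniformlyOn_finsetRange.continuousOn
      (Frequently.of_forall fun n => by fun_prop)
  simpa [qPochInf, sub_eq_add_neg] using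
    hc.continuousAt (Metric.isOpen_ball.mem_nhds (by simp))

end Infinite

section Sums

/-- The quadratic exponent beats every geometric growth. -/
lemma summable_pow_choose_mul_pow {q : ℝ} (hq0 : 0 < q) (hq1 : q < 1) {C : ℝ} (hC : 0 < C) :
    Summable fun m : ℕ => q ^ m.choose 2 * C ^ m := by
  refine summable_of_ratio_test_tendsto_lt_one (l := 0) zero_lt_one
    (Eventually.of_forall fun n => by positivity) ?_
  have h : Tendsto (fun n : ℕ => q ^ n * C) atTop (𝓝 (0 * C)) :=
    (tendsto_pow_atTop_nhds_zero_of_lt_one hq0.le hq1).mul_const C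
  rw [zero_mul] at h
  refine h.congr fun n => ?_
  have e : (n + 1).choose 2 = n + n.choose 2 := by simp [Nat.choose_succ_succ']
  rw [e, pow_add, pow_succ, Real.norm_of_nonneg (by positivity), Real.norm_of_nonneg (by positivity)]
  field_simp

lemma sq_eq_two_mul_choose_add (m : ℕ) : m ^ 2 = 2 * m.choose 2 + m := by
  induction m with
  | zero => rfl
  | succ k ih =>
    have e : (k + 1).choose 2 = k + k.choose 2 := by simp [Nat.choose_succ_succ']
    rw [e]; nlinarith

lemma summable_pow_sq_mul_pow {q : ℝ} (hq0 : 0 < q) (hq1 : q < 1) {C : ℝ} (hC : 0 < C) :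
    Summable fun m : ℕ => q ^ m ^ 2 * C ^ m := by
  refine (summable_pow_choose_mul_pow (q := q ^ 2) (C := q * C) (by positivity)
    (by nlinarith) (by positivity)).congr fun m => ?_
  rw [sq_eq_two_mul_choose_add, pow_add, pow_mul, mul_pow, mul_assoc]

end Sums

/-! ### The series of Euler and Cauchy -/

section QExponential
variable {q : ℝ}

/-- Euler's `q`-exponential series `∑ b^k / (q;q)_k`. -/
noncomputable def qExpSum (q b : ℝ) : ℝ := ∑' k : ℕ, b ^ k / qFac q q k

lemma summable_qExpSum (hq0 : 0 < q) (hq1 : q < 1) {b : ℝ} (hb0 : 0 ≤ b) (hb1 : b < 1) :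
    Summable fun k : ℕ => b ^ k / qFac q q k := by
  rcases hb0.eq_or_lt with rfl | hb
  · exact summable_of_ne_finset_zero (s := {0}) fun k hk => by
      simp at hk; simp [hk]
  have hp := qFac_pos hq0 hq1 hq1
  refine summable_of_ratio_test_tendsto_lt_one hb1
    (Eventually.of_forall fun n => (div_pos (pow_pos hb n) (hp n)).ne') ?_
  have h : Tendsto (fun n : ℕ => b / (1 - q * q ^ n)) atTop (𝓝 (b / (1 - q * 0))) :=
    tendsto_const_nhds.div (tendsto_const_nhds.sub
      ((tendsto_pow_atTop_nhds_zero_of_lt_one hq0.le hq1).const_mul q)) (by simp)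
  rw [mul_zero, sub_zero, div_one] at h
  refine h.congr fun n => ?_
  have h1 := hp n
  have h2 := hp (n + 1)
  have h3 : 0 < 1 - q * q ^ n := sub_pos.2 (mul_pow_lt_one hq0 hq1 hq1 n)
  rw [Real.norm_of_nonneg (by positivity), Real.norm_of_nonneg (by positivity), qFac_succ, pow_succ]
  field_simp

lemma one_le_qExpSum (hq0 : 0 < q) (hq1 : q < 1) {b : ℝ} (hb0 : 0 ≤ b) (hb1 : b < 1) :
    1 ≤ qExpSum q b := by
  have h := (summable_qExpSum hq0 hq1 hb0 hb1).le_tsum 0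
    (fun k _ => div_nonneg (pow_nonneg hb0 k) (qFac_pos hq0 hq1 hq1 k).le)
  rw [pow_zero, qFac_zero, div_one] at h
  exact h

lemma qExpSum_mul_self (hq0 : 0 < q) (hq1 : q < 1) {b : ℝ} (hb0 : 0 ≤ b) (hb1 : b < 1) :
    qExpSum q (b * q) = (1 - b) * qExpSum q b := by
  have hbq : b * q < 1 := by nlinarith
  have s1 := summable_qExpSum hq0 hq1 hb0 hb1
  have s2 := summable_qExpSum hq0 hq1 (by positivity : 0 ≤ b * q) hbq
  have key : qExpSum q b - qExpSum q (b * q) = b * qExpSum q b := by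
    unfold qExpSum
    rw [← s1.tsum_sub s2, (s1.sub s2).tsum_eq_zero_add, ← tsum_mul_left]
    simp only [pow_zero, sub_self, zero_add]
    congr 1; ext k
    have h1 := qFac_pos hq0 hq1 hq1 k
    have h3 : 0 < 1 - q * q ^ k := sub_pos.2 (mul_pow_lt_one hq0 hq1 hq1 k)
    rw [qFac_succ]
    field_simp
    ring
  linarith

lemma qFac_mul_qExpSum (hq0 : 0 < q) (hq1 : q < 1) {b : ℝ} (hb0 : 0 ≤ b) (hb1 : b < 1) (n : ℕ) :
    qFac b q n * qExpSum q b = qExpSum q (b * q ^ n) := by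
  induction n with
  | zero => simp
  | succ n ih =>
    have h1 : b * q ^ n < 1 := mul_pow_lt_one hq0 hq1 hb1 n
    rw [qFac_succ, pow_succ, ← mul_assoc b, qExpSum_mul_self hq0 hq1 (by positivity) h1, ← ih]
    ring

/-- A positive lower bound for the finite `q`-shifted factorials, uniform in their length. -/
lemma inv_qExpSum_le_qFac (hq0 : 0 < q) (hq1 : q < 1) {b : ℝ} (hb0 : 0 ≤ b) (hb1 : b < 1) (n : ℕ) :
    (qExpSum q b)⁻¹ ≤ qFac b q n := by
  have h1 : b * q ^ n < 1 := mul_pow_lt_one hq0 hq1 hb1 n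
  have h := one_le_qExpSum hq0 hq1 (by positivity : 0 ≤ b * q ^ n) h1
  rw [← qFac_mul_qExpSum hq0 hq1 hb0 hb1] at h
  have hE := one_le_qExpSum hq0 hq1 hb0 hb1
  rw [inv_le_iff_one_le_mul₀ (by linarith)]
  linarith

/-- Tannery's theorem for a family that is dominated by a geometric decay in all but its
zeroth term. -/
lemma tendsto_tsum_one_of_decay {q : ℝ} (hq0 : 0 < q) (hq1 : q < 1) {f : ℕ → ℕ → ℝ} {B : ℕ → ℝ}
    (hB : Summable B) (h0 : ∀ N, f N 0 = 1) (hf : ∀ N k, 0 ≤ f N k)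
    (hle : ∀ N k, f N k ≤ B k * (q ^ N) ^ k) :
    Tendsto (fun N => ∑' k, f N k) atTop (𝓝 1) := by
  have hB0 : ∀ k, 0 ≤ B k := fun k => by simpa using (hf 0 k).trans (hle 0 k)
  have hlim : ∀ k : ℕ, Tendsto (fun N => f N k) atTop (𝓝 (if k = 0 then 1 else 0)) := by
    intro k
    rcases eq_or_ne k 0 with rfl | hk
    · simp [h0]
    · rw [if_neg hk]
      refine squeeze_zero (fun N => hf N k) (fun N => hle N k) ?_
      simpa [hk] using (((tendsto_pow_atTop_nhds_zero_of_lt_one hq0.le hq1).pow k).const_mul (B k))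
  have h := tendsto_tsum_of_dominated_convergence hB hlim (Eventually.of_forall fun N k => by
    rw [Real.norm_of_nonneg (hf N k)]
    exact (hle N k).trans (mul_le_of_le_one_right (hB0 k)
      (pow_le_one₀ (by positivity) (pow_le_one₀ hq0.le hq1.le))))
  simpa using h

lemma qPochInf_mul_eq_one {q z g : ℝ} (hq0 : 0 < q) (hq1 : q < 1)
    (h : Tendsto (fun N => qFac z q N * g) atTop (𝓝 1)) : qPochInf z q * g = 1 := by
  have hq : ‖(q : ℂ)‖ < 1 := by simpa [abs_of_pos hq0] using hq1
  refine tendsto_nhds_unique ((tendsto_qFac hq (z : ℂ)).mul_const (g : ℂ)) ?_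
  have := (Complex.continuous_ofReal.tendsto _).comp h
  simpa [Function.comp_def, ofReal_qFac] using this

/-- Euler's identity `∑ b^k / (q;q)_k = 1 / (b;q)_∞`. -/
lemma qPochInf_mul_qExpSum (hq0 : 0 < q) (hq1 : q < 1) {b : ℝ} (hb0 : 0 ≤ b) (hb1 : b < 1) :
    qPochInf b q * qExpSum q b = 1 := by
  refine qPochInf_mul_eq_one hq0 hq1 ?_
  simp_rw [qFac_mul_qExpSum hq0 hq1 hb0 hb1]
  refine tendsto_tsum_one_of_decay hq0 hq1 (summable_qExpSum hq0 hq1 hb0 hb1) (by simp) ?_ ?_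
  · intro N k
    have := qFac_pos hq0 hq1 hq1 k
    positivity
  · intro N k
    rw [mul_pow, div_mul_eq_mul_div]

end QExponential

section Cauchy
variable {q : ℝ}

/-- The terms `q^{s²} b^s / ((q;q)_s (bq;q)_s)` of Cauchy's series. For `b = a` they are the
unnormalised masses, at the points `q^{-s}`, of an orthogonality measure of the polynomials
`V_n^{(a)}`. -/
noncomputable def cauchyTerm (q b : ℝ) (s : ℕ) : ℝ :=
  q ^ s ^ 2 * b ^ s / (qFac q q s * qFac (b * q) q s)

lemma cauchyTerm_pos (hq0 : 0 < q) (hq1 : q < 1) {b : ℝ} (hb0 : 0 < b) (hb1 : b * q < 1) (s : ℕ) :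
    0 < cauchyTerm q b s := by
  have h1 := qFac_pos hq0 hq1 hq1 s
  have h2 := qFac_pos hq0 hq1 hb1 s
  unfold cauchyTerm; positivity

/-- Cauchy's terms decay faster than every geometric series. -/
lemma summable_cauchyTerm_mul_pow (hq0 : 0 < q) (hq1 : q < 1) {b : ℝ} (hb0 : 0 < b)
    (hb1 : b * q < 1) {C : ℝ} (hC : 0 < C) : Summable fun s => cauchyTerm q b s * C ^ s := by
  have hbq : 0 ≤ b * q := by positivity
  refine Summable.of_nonneg_of_le
    (fun s => mul_nonneg (cauchyTerm_pos hq0 hq1 hb0 hb1 s).le (by positivity)) (fun s => ?_)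
    ((summable_pow_sq_mul_pow hq0 hq1 (mul_pos hb0 hC)).mul_left (qExpSum q q * qExpSum q (b * q)))
  have h1 := qFac_pos hq0 hq1 hq1 s
  have h2 := qFac_pos hq0 hq1 hb1 s
  have h3 := inv_qExpSum_le_qFac hq0 hq1 hq0.le hq1 s
  have h4 := inv_qExpSum_le_qFac hq0 hq1 hbq hb1 s
  have e1 := one_le_qExpSum hq0 hq1 hq0.le hq1
  have e2 := one_le_qExpSum hq0 hq1 hbq hb1
  have h5 : (qFac q q s)⁻¹ ≤ qExpSum q q := inv_le_of_inv_le₀ (by linarith) h3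
  have h6 : (qFac (b * q) q s)⁻¹ ≤ qExpSum q (b * q) := inv_le_of_inv_le₀ (by linarith) h4
  calc cauchyTerm q b s * C ^ s
      = ((qFac q q s)⁻¹ * (qFac (b * q) q s)⁻¹) * (q ^ s ^ 2 * (b * C) ^ s) := by
        unfold cauchyTerm; rw [mul_pow, div_eq_mul_inv, mul_inv]; ring
    _ ≤ _ := by gcongr

lemma summable_cauchyTerm (hq0 : 0 < q) (hq1 : q < 1) {b : ℝ} (hb0 : 0 < b) (hb1 : b * q < 1) :
    Summable (cauchyTerm q b) := by
  simpa using summable_cauchyTerm_mul_pow hq0 hq1 hb0 hb1 one_pos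

/-- The telescoping that turns Cauchy's series at `b q` into the one at `b`. -/
lemma cauchyTerm_sub (hq0 : 0 < q) (hq1 : q < 1) {b : ℝ} (hb1 : b * q < 1)
    (hb1' : b * q * q < 1) (s : ℕ) :
    cauchyTerm q b s - cauchyTerm q (b * q) s / (1 - b * q) =
      cauchyTerm q b s * (1 - q ^ s) - cauchyTerm q b (s + 1) * (1 - q ^ (s + 1)) := by
  have h1 := (qFac_pos hq0 hq1 hq1 s).ne'
  have h2 := (qFac_pos hq0 hq1 hb1 s).ne'
  have h3 := (qFac_pos hq0 hq1 hb1' s).ne'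
  have h4 : 1 - q * q ^ s ≠ 0 := (sub_pos.2 (mul_pow_lt_one hq0 hq1 hq1 s)).ne'
  have h5 : 1 - b * q * q ^ s ≠ 0 := (sub_pos.2 (mul_pow_lt_one hq0 hq1 hb1 s)).ne'
  have h6 : 1 - b * q ≠ 0 := (sub_pos.2 hb1).ne'
  have e : (1 - b * q) * qFac (b * q * q) q s = qFac (b * q) q s * (1 - b * q * q ^ s) := by
    rw [← qFac_succ', qFac_succ]
  have e1 : cauchyTerm q (b * q) s / (1 - b * q) =
      cauchyTerm q b s * (q ^ s / (1 - b * q * q ^ s)) := by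
    unfold cauchyTerm
    rw [div_div, mul_assoc (qFac q q s), mul_comm (qFac (b * q * q) q s), e, mul_pow b q]
    field_simp
  have e2 : cauchyTerm q b (s + 1) =
      cauchyTerm q b s * (q ^ (2 * s + 1) * b / ((1 - q * q ^ s) * (1 - b * q * q ^ s))) := by
    unfold cauchyTerm
    rw [qFac_succ, qFac_succ, show (s + 1) ^ 2 = s ^ 2 + (2 * s + 1) by ring, pow_add q, pow_succ b]
    field_simp
  rw [e1, e2, pow_succ' q s, show 2 * s + 1 = s + s + 1 by ring, pow_succ q (s + s), pow_add]
  clear e e1 e2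
  generalize cauchyTerm q b s = t
  generalize q ^ s = y at h4 h5
  generalize hu : 1 - q * y = u at h4
  generalize hv : 1 - b * q * y = v at h5
  field_simp
  subst hu hv
  ring

lemma tsum_cauchyTerm_mul_self (hq0 : 0 < q) (hq1 : q < 1) {b : ℝ} (hb0 : 0 < b)
    (hb1 : b * q < 1) :
    ∑' s, cauchyTerm q (b * q) s = (1 - b * q) * ∑' s, cauchyTerm q b s := by
  have hb1' : b * q * q < 1 := by nlinarith
  have s1 := summable_cauchyTerm hq0 hq1 hb0 hb1
  have s2 := summable_cauchyTerm hq0 hq1 (mul_pos hb0 hq0) hb1'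
  have h6 : 1 - b * q ≠ 0 := (sub_pos.2 hb1).ne'
  have s3 : Summable fun s => cauchyTerm q b s * (1 - q ^ s) := by
    refine Summable.of_nonneg_of_le (fun s => ?_) (fun s => ?_) s1
    · exact mul_nonneg (cauchyTerm_pos hq0 hq1 hb0 hb1 s).le
        (sub_nonneg.2 (pow_le_one₀ hq0.le hq1.le))
    · exact mul_le_of_le_one_right (cauchyTerm_pos hq0 hq1 hb0 hb1 s).le
        (by linarith [pow_pos hq0 s])
  have key : ∑' s, (cauchyTerm q b s - cauchyTerm q (b * q) s / (1 - b * q)) = 0 := by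
    simp_rw [cauchyTerm_sub hq0 hq1 hb1 hb1']
    rw [s3.tsum_sub ((summable_nat_add_iff 1).2 s3), s3.tsum_eq_zero_add]
    simp
  rw [s1.tsum_sub (s2.div_const _), tsum_div_const, sub_eq_zero, eq_div_iff h6] at key
  linarith

lemma tsum_cauchyTerm_mul_pow (hq0 : 0 < q) (hq1 : q < 1) {b : ℝ} (hb0 : 0 < b)
    (hb1 : b * q < 1) (n : ℕ) :
    ∑' s, cauchyTerm q (b * q ^ n) s = qFac (b * q) q n * ∑' s, cauchyTerm q b s := by
  induction n with
  | zero => simp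
  | succ n ih =>
    have h1 : b * q ^ n * q < 1 := by
      have := mul_pow_lt_one hq0 hq1 hb1 n
      linarith [mul_right_comm b q (q ^ n)]
    rw [pow_succ, ← mul_assoc, tsum_cauchyTerm_mul_self hq0 hq1 (by positivity) h1, ih, qFac_succ]
    ring

/-- Cauchy's identity `∑ q^{s²} b^s / ((q;q)_s (bq;q)_s) = 1 / (bq;q)_∞`. -/
lemma qPochInf_mul_tsum_cauchyTerm (hq0 : 0 < q) (hq1 : q < 1) {b : ℝ} (hb0 : 0 < b)
    (hb1 : b * q < 1) :
    qPochInf ((b * q : ℝ) : ℂ) q * (∑' s, cauchyTerm q b s : ℝ) = 1 := by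
  refine qPochInf_mul_eq_one hq0 hq1 ?_
  simp_rw [← tsum_cauchyTerm_mul_pow hq0 hq1 hb0 hb1]
  have hbN : ∀ N : ℕ, b * q ^ N * q < 1 := fun N => by
    have := mul_pow_lt_one hq0 hq1 hb1 N
    linarith [mul_right_comm b q (q ^ N)]
  refine tendsto_tsum_one_of_decay hq0 hq1 (summable_cauchyTerm hq0 hq1 hb0 hb1) ?_ ?_ ?_
  · simp [cauchyTerm]
  · exact fun N k => (cauchyTerm_pos hq0 hq1 (by positivity) (hbN N) k).le
  · intro N k
    have h1 := qFac_pos hq0 hq1 hq1 k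
    have h2 := qFac_pos hq0 hq1 hb1 k
    have h3 : qFac (b * q) q k ≤ qFac (b * q ^ N * q) q k := by
      refine Finset.prod_le_prod (fun i _ => (sub_pos.2 (mul_pow_lt_one hq0 hq1 hb1 i)).le) ?_
      intro i _
      have : b * q ^ N ≤ b := mul_le_of_le_one_right hb0.le (pow_le_one₀ hq0.le hq1.le)
      gcongr
    unfold cauchyTerm
    rw [mul_pow b, ← mul_assoc, div_mul_eq_mul_div]
    gcongr

lemma tsum_cauchyTerm_pos (hq0 : 0 < q) (hq1 : q < 1) {b : ℝ} (hb0 : 0 < b) (hb1 : b * q < 1) :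
    0 < ∑' s, cauchyTerm q b s :=
  (summable_cauchyTerm hq0 hq1 hb0 hb1).tsum_pos
    (fun s => (cauchyTerm_pos hq0 hq1 hb0 hb1 s).le) 0 (cauchyTerm_pos hq0 hq1 hb0 hb1 0)

end Cauchy

/-! ### Lagrange interpolation at the points `q^{-m}` -/

section Lagrange

/-- Superexponentially small weights make the values of a polynomial at the points `q^{-m}`
summable. -/
lemma summable_mul_eval {q : ℝ} (hq0 : 0 < q) {g : ℕ → ℝ}
    (hg : ∀ C : ℝ, 0 < C → Summable fun m => g m * C ^ m) (P : ℝ[X]) :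
    Summable fun m => g m * P.eval (q ^ m)⁻¹ := by
  induction P using Polynomial.induction_on' with
  | add P Q hP hQ => simpa [mul_add] using hP.add hQ
  | monomial n c =>
    refine ((hg ((q ^ n)⁻¹) (by positivity)).mul_left c).congr fun m => ?_
    rw [eval_monomial, inv_pow, inv_pow, ← pow_mul, ← pow_mul, mul_comm n m]
    ring

lemma prod_pow_succ_eq {K : Type*} [CommRing K] (q : K) (m : ℕ) :
    ∏ i ∈ Finset.range m, q ^ (i + 1) = q ^ (m + 1).choose 2 := by
  induction m with
  | zero => simp
  | succ m ih =>
    rw [Finset.prod_range_succ, ih, ← pow_add, Nat.choose_succ_succ' (m + 1) 1, Nat.choose_one_right,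
      add_comm]

/-- The Lagrange basis polynomials for the nodes `1, q^{-1}, …, q^{-(m+r)}`. -/
lemma eval_lagrangeBasis {K : Type*} [Field K] {q : K} (hq : q ≠ 0)
    (hn : ∀ n : ℕ, 1 - q * q ^ n ≠ 0) (x : K) (m r : ℕ) :
    (Lagrange.basis (Finset.range (m + 1 + r)) (fun k => (q ^ k)⁻¹) m).eval x =
      qFac x q m * qFac (x * q ^ (m + 1)) q r *
        ((-1) ^ m * q ^ (m + 1).choose 2 / (qFac q q m * qFac q q r)) := by
  have hs : (Finset.range (m + 1 + r)).erase m =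
      Finset.range m ∪ Finset.Ico (m + 1) (m + 1 + r) := by
    ext k; simp; omega
  have hd : Disjoint (Finset.range m) (Finset.Ico (m + 1) (m + 1 + r)) := by
    rw [Finset.disjoint_left]; intro k; simp; omega
  have hlow : ∏ k ∈ Finset.range m, ((q ^ m)⁻¹ - (q ^ k)⁻¹)⁻¹ * (x - (q ^ k)⁻¹) =
      qFac x q m * ((-1) ^ m * q ^ (m + 1).choose 2 / qFac q q m) := by
    calc ∏ k ∈ Finset.range m, ((q ^ m)⁻¹ - (q ^ k)⁻¹)⁻¹ * (x - (q ^ k)⁻¹)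
        = ∏ k ∈ Finset.range m, (1 - x * q ^ k) *
            ((-1) * q ^ (m - 1 - k + 1) / (1 - q * q ^ (m - 1 - k))) := by
          refine Finset.prod_congr rfl fun k hk => ?_
          obtain ⟨j, rfl⟩ : ∃ j, m = k + 1 + j := ⟨m - (k + 1), by
            have := Finset.mem_range.1 hk; omega⟩
          have e : k + 1 + j - 1 - k = j := by omega
          have h1 := hn j
          have h2 : (q ^ (k + 1 + j))⁻¹ - (q ^ k)⁻¹ = (q ^ (k + 1 + j))⁻¹ * (1 - q * q ^ j) := by
            rw [pow_add, pow_add]; field_simp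
          rw [e, h2]
          field_simp
          ring
      _ = _ := by
          rw [Finset.prod_mul_distrib,
            Finset.prod_range_reflect (fun j => (-1) * q ^ (j + 1) / (1 - q * q ^ j)) m,
            Finset.prod_div_distrib, Finset.prod_mul_distrib, prod_pow_succ_eq]
          simp [qFac]
  have hhigh : ∏ k ∈ Finset.Ico (m + 1) (m + 1 + r),
      ((q ^ m)⁻¹ - (q ^ k)⁻¹)⁻¹ * (x - (q ^ k)⁻¹) =
      qFac (x * q ^ (m + 1)) q r / qFac q q r := by
    rw [Finset.prod_Ico_eq_prod_range, add_tsub_cancel_left, qFac, qFac, ← Finset.prod_div_distrib]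
    refine Finset.prod_congr rfl fun i _ => ?_
    have h1 := hn i
    have h2 : (q ^ m)⁻¹ - (q ^ (m + 1 + i))⁻¹ = -(q ^ (m + 1 + i))⁻¹ * (1 - q * q ^ i) := by
      rw [pow_add, pow_add]; field_simp; ring
    rw [h2, mul_assoc x, ← pow_add]
    field_simp
    ring
  simp only [Lagrange.basis, Lagrange.basisDivisor, eval_prod, eval_mul, eval_C, eval_sub, eval_X]
  rw [hs, Finset.prod_union hd, hlow, hhigh]
  simp only [div_eq_mul_inv, mul_inv]
  ring

variable {q : ℝ}

/-- The infinite product `(x;q)_∞` with its factor `1 - x q^m` left out, an entire function. -/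
noncomputable def qPochInfOmit (q : ℝ) (m : ℕ) (x : ℂ) : ℂ :=
  qFac x (q : ℂ) m * qPochInf (x * (q : ℂ) ^ (m + 1)) q

/-- The Lagrange interpolation functions for the nodes `q^{-m}`, `m ≥ 0`: the entire function
`lagrangeFun q m` is `1` at `q^{-m}` and vanishes at the other nodes. -/
noncomputable def lagrangeFun (q : ℝ) (m : ℕ) (x : ℂ) : ℂ :=
  qPochInfOmit q m x * ((-1) ^ m * (q : ℂ) ^ (m + 1).choose 2 / (qFac (q : ℂ) q m * qPochInf q q))

lemma norm_ofReal_lt_one (hq0 : 0 < q) (hq1 : q < 1) : ‖(q : ℂ)‖ < 1 := by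
  simpa [abs_of_pos hq0] using hq1

lemma one_sub_mul_pow_ne_zero (hq0 : 0 < q) (hq1 : q < 1) (n : ℕ) :
    1 - (q : ℂ) * (q : ℂ) ^ n ≠ 0 := by
  have := (sub_pos.2 (mul_pow_lt_one hq0 hq1 hq1 n)).ne'
  exact_mod_cast this

lemma qPochInf_self_ne_zero (hq0 : 0 < q) (hq1 : q < 1) : qPochInf q q ≠ 0 :=
  left_ne_zero_of_mul_eq_one (qPochInf_mul_qExpSum hq0 hq1 hq0.le hq1)

lemma norm_inv_qFac_self_le (hq0 : 0 < q) (hq1 : q < 1) (n : ℕ) :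
    ‖(qFac (q : ℂ) q n)⁻¹‖ ≤ qExpSum q q := by
  have e1 := one_le_qExpSum hq0 hq1 hq0.le hq1
  rw [← ofReal_qFac, ← Complex.ofReal_inv, Complex.norm_real,
    Real.norm_of_nonneg (inv_nonneg.2 (qFac_pos hq0 hq1 hq1 n).le)]
  exact inv_le_of_inv_le₀ (by linarith) (inv_qExpSum_le_qFac hq0 hq1 hq0.le hq1 n)

lemma norm_qFac_mul_pow_le (hq0 : 0 < q) (hq1 : q < 1) (x : ℂ) (m n : ℕ) :
    ‖qFac (x * (q : ℂ) ^ m) q n‖ ≤ Real.exp (‖x‖ * (1 - q)⁻¹) := by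
  have h := norm_qFac_le (norm_ofReal_lt_one hq0 hq1) (x * (q : ℂ) ^ m) n
  refine h.trans (Real.exp_le_exp.2 ?_)
  have e : ‖(q : ℂ)‖ = q := by simp [abs_of_pos hq0]
  have h1 : 0 ≤ (1 - q)⁻¹ := inv_nonneg.2 (by linarith)
  rw [norm_mul, norm_pow, e]
  exact mul_le_mul_of_nonneg_right
    (mul_le_of_le_one_right (norm_nonneg x) (pow_le_one₀ hq0.le hq1.le)) h1

/-- Every polynomial is the sum of its Lagrange interpolation series at the nodes `q^{-m}`. -/
theorem hasSum_eval_mul_lagrangeFun (hq0 : 0 < q) (hq1 : q < 1) (P : ℝ[X]) (x : ℂ) :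
    HasSum (fun m : ℕ => ((P.eval (q ^ m)⁻¹ : ℝ) : ℂ) * lagrangeFun q m x) (aeval x P) := by
  have hqC : (q : ℂ) ≠ 0 := by exact_mod_cast hq0.ne'
  have hq := norm_ofReal_lt_one hq0 hq1
  have hn := one_sub_mul_pow_ne_zero hq0 hq1
  set B : ℂ → ℕ → ℕ → ℂ := fun x N m =>
    (Lagrange.basis (Finset.range N) (fun k => ((q : ℂ) ^ k)⁻¹) m).eval x with hB
  set M : ℝ := Real.exp (‖x‖ * (1 - q)⁻¹) with hM
  set E : ℝ := qExpSum q q with hE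
  have hE1 : 1 ≤ E := one_le_qExpSum hq0 hq1 hq0.le hq1
  have hinj : Function.Injective fun k : ℕ => ((q : ℂ) ^ k)⁻¹ := by
    intro i j hij
    have h : q ^ i = q ^ j := by exact_mod_cast inv_injective hij
    exact (pow_right_strictAnti₀ hq0 hq1).injective h
  -- Interpolation at the first `N` nodes is exact for large `N`; the limit is taken term by term.
  set f : ℕ → ℕ → ℂ := fun N m =>
    if m < N then ((P.eval (q ^ m)⁻¹ : ℝ) : ℂ) * B x N m else 0 with hf
  have hfin : ∀ N, P.natDegree < N → ∑' m, f N m = aeval x P := by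
    intro N hN
    have h1 := Lagrange.eq_interpolate (s := Finset.range N) (v := fun k => ((q : ℂ) ^ k)⁻¹)
      (f := P.map (algebraMap ℝ ℂ)) hinj.injOn (by
        rw [Finset.card_range]
        exact lt_of_le_of_lt (degree_map_le.trans degree_le_natDegree) (by exact_mod_cast hN))
    rw [aeval_def, ← eval_map, h1, Lagrange.interpolate_apply, eval_finsetSum,
      tsum_eq_sum (s := Finset.range N) (fun m hm => by
        simp only [hf]; rw [if_neg (by simpa using hm)])]
    refine Finset.sum_congr rfl fun m hm => ?_
    simp only [hf]
    rw [if_pos (by simpa using hm), eval_mul, eval_C]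
    congr 1
    have : ((q : ℂ) ^ m)⁻¹ = algebraMap ℝ ℂ ((q ^ m)⁻¹) := by simp
    rw [this, eval_map, eval₂_at_apply]; rfl
  have hlim : ∀ m, Tendsto (fun N => f N m) atTop
      (𝓝 (((P.eval (q ^ m)⁻¹ : ℝ) : ℂ) * lagrangeFun q m x)) := by
    intro m
    rw [← tendsto_add_atTop_iff_nat (m + 1)]
    have h1 : ∀ r, f (r + (m + 1)) m = ((P.eval (q ^ m)⁻¹ : ℝ) : ℂ) *
        (qFac x q m * qFac (x * (q : ℂ) ^ (m + 1)) q r *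
        ((-1) ^ m * (q : ℂ) ^ (m + 1).choose 2 / (qFac (q : ℂ) q m * qFac (q : ℂ) q r))) := by
      intro r
      simp only [hf, hB]
      rw [if_pos (by omega), add_comm r, eval_lagrangeBasis hqC hn]
    simp_rw [h1]
    refine Tendsto.const_mul _ (((tendsto_qFac hq _).const_mul _).mul (Tendsto.div
      tendsto_const_nhds ((tendsto_qFac hq _).const_mul _) (mul_ne_zero ?_
        (qPochInf_self_ne_zero hq0 hq1))))
    exact Finset.prod_ne_zero_iff.2 fun k _ => hn k
  have hg : ∀ C : ℝ, 0 < C → Summable fun m : ℕ => q ^ (m + 1).choose 2 * C ^ m := by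
    intro C hC
    refine (summable_pow_choose_mul_pow hq0 hq1 (mul_pos hq0 hC)).congr fun m => ?_
    rw [Nat.choose_succ_succ' m 1, Nat.choose_one_right, pow_add, mul_pow]; ring
  have hsum : Summable fun m : ℕ => |q ^ (m + 1).choose 2 * P.eval (q ^ m)⁻¹| * (M * M * (E * E)) :=
    ((summable_mul_eval hq0 hg P).abs).mul_right _
  have hbound : ∀ N m, ‖f N m‖ ≤ |q ^ (m + 1).choose 2 * P.eval (q ^ m)⁻¹| * (M * M * (E * E)) := by
    intro N m
    have hpos : 0 ≤ |q ^ (m + 1).choose 2 * P.eval (q ^ m)⁻¹| * (M * M * (E * E)) := by positivity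
    by_cases hm : m < N
    · obtain ⟨r, rfl⟩ : ∃ r, N = m + 1 + r := ⟨N - (m + 1), by omega⟩
      simp only [hf, hB]
      rw [if_pos hm, eval_lagrangeBasis hqC hn, div_eq_mul_inv, mul_inv]
      have b1 : ‖qFac x (q : ℂ) m‖ ≤ M := by simpa using norm_qFac_mul_pow_le hq0 hq1 x 0 m
      have b2 := norm_qFac_mul_pow_le hq0 hq1 x (m + 1) r
      have b3 := norm_inv_qFac_self_le hq0 hq1 m
      have b4 := norm_inv_qFac_self_le hq0 hq1 r
      have e : ‖(q : ℂ)‖ = q := by simp [abs_of_pos hq0]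
      simp only [norm_mul, norm_pow, norm_neg, norm_one, one_pow, one_mul, e, Complex.norm_real,
        Real.norm_eq_abs, abs_mul, abs_of_pos (pow_pos hq0 _)]
      calc |P.eval (q ^ m)⁻¹| * (‖qFac x (q : ℂ) m‖ * ‖qFac (x * (q : ℂ) ^ (m + 1)) q r‖ *
            (q ^ (m + 1).choose 2 * (‖(qFac (q : ℂ) q m)⁻¹‖ * ‖(qFac (q : ℂ) q r)⁻¹‖)))
          ≤ |P.eval (q ^ m)⁻¹| * (M * M * (q ^ (m + 1).choose 2 * (E * E))) := by gcongr
        _ = _ := by ring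
    · simp only [hf]
      rw [if_neg hm, norm_zero]
      exact hpos
  have hT := tendsto_tsum_of_dominated_convergence hsum hlim (Eventually.of_forall hbound)
  have hS : Summable fun m => ((P.eval (q ^ m)⁻¹ : ℝ) : ℂ) * lagrangeFun q m x :=
    hsum.of_norm_bounded fun m => le_of_tendsto (hlim m).norm
      (Eventually.of_forall fun N => hbound N m)
  have := tendsto_nhds_unique hT (tendsto_const_nhds.congr'
    ((eventually_gt_atTop P.natDegree).mono fun N hN => (hfin N hN).symm))
  rw [← this]
  exact hS.hasSum

end Lagrange

/-! ### Mixed moments of the discrete measure -/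

section Functional
variable {q a : ℝ}

/-- The mass at the point `q^{-m}` of the discrete orthogonality measure of the `V_n^{(a)}`. -/
noncomputable def alSalamCarlitzMass (q a : ℝ) (m : ℕ) : ℝ :=
  cauchyTerm q a m / ∑' s, cauchyTerm q a s

lemma alSalamCarlitzMass_pos (hq0 : 0 < q) (hq1 : q < 1) (ha : 0 < a) (haq : a * q < 1) (m : ℕ) :
    0 < alSalamCarlitzMass q a m :=
  div_pos (cauchyTerm_pos hq0 hq1 ha haq m) (tsum_cauchyTerm_pos hq0 hq1 ha haq)

lemma summable_mass_mul_eval (hq0 : 0 < q) (hq1 : q < 1) (ha : 0 < a) (haq : a * q < 1)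
    (P : ℝ[X]) : Summable fun m => alSalamCarlitzMass q a m * P.eval (q ^ m)⁻¹ := by
  refine summable_mul_eval hq0 (fun C hC => ?_) P
  refine ((summable_cauchyTerm_mul_pow hq0 hq1 ha haq hC).div_const
    (∑' s, cauchyTerm q a s)).congr fun m => ?_
  rw [alSalamCarlitzMass]; ring

/-- The sum of a polynomial against the masses `alSalamCarlitzMass q a m` at `q^{-m}`. -/
noncomputable def massSum (q a : ℝ) (P : ℝ[X]) : ℝ :=
  ∑' m, alSalamCarlitzMass q a m * P.eval (q ^ m)⁻¹

lemma massSum_add (hq0 : 0 < q) (hq1 : q < 1) (ha : 0 < a) (haq : a * q < 1) (P Q : ℝ[X]) :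
    massSum q a (P + Q) = massSum q a P + massSum q a Q := by
  simp only [massSum, eval_add, mul_add]
  exact (summable_mass_mul_eval hq0 hq1 ha haq P).tsum_add (summable_mass_mul_eval hq0 hq1 ha haq Q)

lemma massSum_C_mul (c : ℝ) (P : ℝ[X]) : massSum q a (C c * P) = c * massSum q a P := by
  simp only [massSum, eval_mul, eval_C, ← tsum_mul_left]
  congr 1; ext m; ring

lemma massSum_sub (hq0 : 0 < q) (hq1 : q < 1) (ha : 0 < a) (haq : a * q < 1) (P Q : ℝ[X]) :
    massSum q a (P - Q) = massSum q a P - massSum q a Q := by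
  have h := massSum_add hq0 hq1 ha haq P (C (-1) * Q)
  rw [massSum_C_mul] at h
  rw [show P - Q = P + C (-1) * Q by simp [sub_eq_add_neg], h]; ring

lemma massSum_one (hq0 : 0 < q) (hq1 : q < 1) (ha : 0 < a) (haq : a * q < 1) :
    massSum q a 1 = 1 := by
  simp only [massSum, eval_one, mul_one, alSalamCarlitzMass, tsum_div_const]
  exact div_self (tsum_cauchyTerm_pos hq0 hq1 ha haq).ne'

lemma qFac_inv_pow_mul (hq0 : 0 < q) (n s : ℕ) :
    qFac ((q ^ (n + s))⁻¹) q n * q ^ (n * s + (n + 1).choose 2) =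
      (-1) ^ n * qFac (q * q ^ s) q n := by
  induction n with
  | zero => simp
  | succ n ih =>
    have e1 : (q ^ (n + 1 + s))⁻¹ * q = (q ^ (n + s))⁻¹ := by
      rw [show n + 1 + s = n + s + 1 by ring, pow_succ]; field_simp
    have e2 : (n + 1) * s + (n + 1 + 1).choose 2 = (n * s + (n + 1).choose 2) + (n + 1 + s) := by
      rw [Nat.choose_succ_succ' (n + 1) 1, Nat.choose_one_right]; ring
    rw [qFac_succ', e1, e2, pow_add, qFac_succ, pow_succ (-1 : ℝ)]
    have e3 : (1 - (q ^ (n + 1 + s))⁻¹) * q ^ (n + 1 + s) = -(1 - q * q ^ s * q ^ n) := by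
      have : q ^ (n + 1 + s) ≠ 0 := by positivity
      field_simp; ring
    linear_combination (1 - (q ^ (n + 1 + s))⁻¹) * q ^ (n + 1 + s) * ih +
      (-1) ^ n * qFac (q * q ^ s) q n * e3

lemma qFac_inv_pow_eq_zero (hq0 : 0 < q) {m n : ℕ} (h : m < n) :
    qFac ((q ^ m)⁻¹) q n = 0 :=
  Finset.prod_eq_zero (Finset.mem_range.2 h) (by
    have : q ^ m ≠ 0 := by positivity
    rw [inv_mul_cancel₀ this, sub_self])

lemma cauchyTerm_mul_qFac (hq0 : 0 < q) (hq1 : q < 1) (haq : a * q < 1) (n s : ℕ) :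
    cauchyTerm q a (n + s) * qFac ((q ^ (n + s))⁻¹) q n =
      (-a) ^ n * q ^ n.choose 2 / qFac (a * q) q n * cauchyTerm q (a * q ^ n) s := by
  have h1 := qFac_inv_pow_mul hq0 n s
  have h2 : qFac q q (n + s) = qFac q q s * qFac (q * q ^ s) q n := by rw [add_comm, qFac_add]
  have h3 : qFac (a * q) q (n + s) = qFac (a * q) q n * qFac (a * q ^ n * q) q s := by
    rw [qFac_add, mul_right_comm]
  have p1 := (qFac_pos hq0 hq1 hq1 s).ne'
  have p2 := (qFac_pos hq0 hq1 haq n).ne'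
  have p3 : qFac (q * q ^ s) q n ≠ 0 :=
    (qFac_pos hq0 hq1 (mul_pow_lt_one hq0 hq1 hq1 s) n).ne'
  have p4 : qFac (a * q ^ n * q) q s ≠ 0 := by
    intro h; rw [h, mul_zero] at h3
    exact (qFac_pos hq0 hq1 haq (n + s)).ne' h3
  have p5 : q ^ (n * s + (n + 1).choose 2) ≠ 0 := by positivity
  have e : (n + s) ^ 2 = (n * s + (n + 1).choose 2) + (s ^ 2 + n * s + n.choose 2) := by
    have := sq_eq_two_mul_choose_add n
    rw [Nat.choose_succ_succ' n 1, Nat.choose_one_right]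
    nlinarith
  have h1' := eq_div_of_mul_eq p5 h1
  unfold cauchyTerm
  rw [h1', h2, h3, e, pow_add q (n * s + (n + 1).choose 2), pow_add q _ (n.choose 2), pow_add q (s ^ 2),
    mul_pow a (q ^ n), ← pow_mul, pow_add a, neg_pow a n]
  field_simp

/-- The sum of the `q`-shifted factorial `(x;q)_n` against the masses. It vanishes at the first `n`
nodes, and the remaining terms form Cauchy's series at `a q^n`. -/
lemma massSum_qFac (hq0 : 0 < q) (hq1 : q < 1) (ha : 0 < a) (haq : a * q < 1) (n : ℕ) :
    massSum q a (qFac X (C q) n) = (-a) ^ n * q ^ n.choose 2 := by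
  have hev : ∀ t : ℝ, (qFac (X : ℝ[X]) (C q) n).eval t = qFac t q n := fun t => by
    simp [qFac, eval_prod]
  have hs := summable_mass_mul_eval hq0 hq1 ha haq (qFac X (C q) n)
  have hZ := (tsum_cauchyTerm_pos hq0 hq1 ha haq).ne'
  have p2 := (qFac_pos hq0 hq1 haq n).ne'
  rw [massSum, ← hs.sum_add_tsum_nat_add n, Finset.sum_eq_zero, zero_add]
  · have : ∀ s, alSalamCarlitzMass q a (s + n) * (qFac (X : ℝ[X]) (C q) n).eval (q ^ (s + n))⁻¹ =
        (-a) ^ n * q ^ n.choose 2 / qFac (a * q) q n / (∑' s, cauchyTerm q a s) *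
          cauchyTerm q (a * q ^ n) s := by
      intro s
      have := cauchyTerm_mul_qFac hq0 hq1 haq n s
      rw [hev, alSalamCarlitzMass, add_comm s n, div_mul_eq_mul_div, this]; ring
    simp_rw [this]
    rw [tsum_mul_left, tsum_cauchyTerm_mul_pow hq0 hq1 ha haq]
    field_simp
  · intro m hm
    rw [hev, qFac_inv_pow_eq_zero hq0 (Finset.mem_range.1 hm), mul_zero]

lemma X_mul_qFac (hq0 : 0 < q) (j : ℕ) : (X : ℝ[X]) * qFac X (C q) j =
    C (q ^ j)⁻¹ * (qFac X (C q) j - qFac X (C q) (j + 1)) := by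
  have h : (C (q ^ j)⁻¹ : ℝ[X]) * C q ^ j = 1 := by
    rw [← C_pow, ← C_mul, inv_mul_cancel₀ (by positivity), C_1]
  rw [qFac_succ]
  linear_combination (-(X : ℝ[X]) * qFac X (C q) j) * h

/-- The mixed moments of the `V_n` against the `q`-shifted factorials. The last factor vanishes
for `j < n`: this is the orthogonality of the `V_n`. -/
lemma massSum_qFac_mul_V (hq0 : 0 < q) (hq1 : q < 1) (ha : 0 < a) (haq : a * q < 1) (n : ℕ) :
    ∀ j, massSum q a (qFac X (C q) j * alSalamCarlitzV a q n) =
      (-a) ^ j * q ^ j.choose 2 * ((q ^ j) ^ n)⁻¹ * qFac (q ^ j) q⁻¹ n := by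
  have hX : ∀ j (P : ℝ[X]), massSum q a (qFac X (C q) j * (X * P)) =
      (q ^ j)⁻¹ * (massSum q a (qFac X (C q) j * P) - massSum q a (qFac X (C q) (j + 1) * P)) := by
    intro j P
    rw [show qFac X (C q) j * (X * P) = (X * qFac X (C q) j) * P by ring, X_mul_qFac hq0,
      mul_assoc, massSum_C_mul, sub_mul, massSum_sub hq0 hq1 ha haq]
  have ech : ∀ j : ℕ, (j + 1).choose 2 = j + j.choose 2 := fun j => by
    rw [Nat.choose_succ_succ' j 1, Nat.choose_one_right]
  have eF : ∀ j n : ℕ, qFac (q ^ (j + 1)) q⁻¹ (n + 1) = (1 - q ^ (j + 1)) * qFac (q ^ j) q⁻¹ n := by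
    intro j n
    rw [qFac_succ', pow_succ, mul_inv_cancel_right₀ hq0.ne']
  induction n using Nat.twoStepInduction with
  | zero => intro j; simp [alSalamCarlitzV, massSum_qFac hq0 hq1 ha haq]
  | one =>
    intro j
    have h0 : (alSalamCarlitzV a q 1) = X * 1 - C (1 + a) * 1 := by simp [alSalamCarlitzV]
    rw [h0, mul_sub, massSum_sub hq0 hq1 ha haq, hX, mul_left_comm _ (C (1 + a)), massSum_C_mul,
      mul_one, mul_one, massSum_qFac hq0 hq1 ha haq, massSum_qFac hq0 hq1 ha haq, ech, pow_add,
      pow_succ (-a), qFac_succ]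
    have : q ^ j ≠ 0 := by positivity
    simp only [qFac_zero, pow_zero, pow_one]
    field_simp
    ring
  | more n ih0 ih1 =>
    intro j
    have hV : alSalamCarlitzV a q (n + 2) = X * alSalamCarlitzV a q (n + 1)
      - C ((1 + a) * (q ^ (n + 1))⁻¹) * alSalamCarlitzV a q (n + 1)
      - C (a * (q ^ (2 * n + 1))⁻¹ * (1 - q ^ (n + 1))) * alSalamCarlitzV a q n := by
      rw [alSalamCarlitzV]; ring
    rw [hV, mul_sub, mul_sub, massSum_sub hq0 hq1 ha haq, massSum_sub hq0 hq1 ha haq, hX,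
      mul_left_comm _ (C _), massSum_C_mul, mul_left_comm _ (C _), massSum_C_mul, ih0, ih1, ih1,
      ech, eF, pow_add q j, pow_succ (-a), qFac_succ _ _ (n + 1), qFac_succ _ _ n, pow_succ q j,
      mul_pow (q ^ j) q, inv_pow, inv_pow, pow_succ (q ^ j) (n + 1), pow_succ (q ^ j) n,
      show 2 * n + 1 = n + n + 1 by ring, pow_succ q (n + n), pow_add q n n, pow_succ q n]
    have h1 : q ^ j ≠ 0 := by positivity
    have h2 : q ^ n ≠ 0 := by positivity
    generalize q ^ j = y at h1
    generalize q ^ n = p at h2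
    generalize qFac y q⁻¹ n = T
    have h3 : y ^ n ≠ 0 := pow_ne_zero _ h1
    generalize y ^ n = Y at h3
    field_simp
    ring

end Functional

/-! ### Orthogonality and norms -/

section Orthogonality
variable {q a : ℝ}

lemma monic_natDegree_alSalamCarlitzV (a q : ℝ) (n : ℕ) :
    (alSalamCarlitzV a q n).Monic ∧ (alSalamCarlitzV a q n).natDegree = n := by
  induction n using Nat.twoStepInduction with
  | zero => simp [alSalamCarlitzV]
  | one => exact ⟨by simpa [alSalamCarlitzV] using monic_X_sub_C (1 + a),
      by rw [alSalamCarlitzV]; exact natDegree_X_sub_C (1 + a)⟩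
  | more n ih0 ih1 =>
    set c := (1 + a) * (q ^ (n + 1))⁻¹
    set P := (X - C c) * alSalamCarlitzV a q (n + 1)
    set Q := C (a * (q ^ (2 * n + 1))⁻¹ * (1 - q ^ (n + 1))) * alSalamCarlitzV a q n
    have hP : P.Monic := (monic_X_sub_C c).mul ih1.1
    have hPd : P.natDegree = n + 2 := by
      rw [(monic_X_sub_C c).natDegree_mul ih1.1, natDegree_X_sub_C, ih1.2]; ring
    have hQ : Q.natDegree < P.natDegree := by
      refine lt_of_le_of_lt (natDegree_C_mul_le _ _) ?_
      rw [hPd, ih0.2]; omega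
    have hV : alSalamCarlitzV a q (n + 2) = P - Q := by rw [alSalamCarlitzV]
    rw [hV]
    exact ⟨hP.sub_of_left (degree_lt_degree hQ),
      (natDegree_sub_eq_left_of_natDegree_lt hQ).trans hPd⟩

lemma degree_alSalamCarlitzV (a q : ℝ) (n : ℕ) : (alSalamCarlitzV a q n).degree = n := by
  obtain ⟨h1, h2⟩ := monic_natDegree_alSalamCarlitzV a q n
  rw [degree_eq_natDegree h1.ne_zero, h2]

/-- A linear functional that kills the members of degree below `n` of a sequence of polynomials,
one for each degree, kills all polynomials of degree below `n`. -/
lemma map_eq_zero_of_degree_lt {φ : ℕ → ℝ[X]} (hφ : ∀ i, (φ i).degree = i) (Λ : ℝ[X] →ₗ[ℝ] ℝ)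
    {n : ℕ} (h : ∀ i < n, Λ (φ i) = 0) {P : ℝ[X]} (hP : P.degree < n) : Λ P = 0 := by
  let S : Polynomial.Sequence ℝ := ⟨φ, hφ⟩
  have hS := S.span_degreeLT (m := n) fun i _ =>
    (leadingCoeff_ne_zero.2 (S.ne_zero i)).isUnit
  have hP' : P ∈ Submodule.span ℝ (S '' Set.Iio n) := by rw [hS]; exact mem_degreeLT.2 hP
  have : Submodule.span ℝ (S '' Set.Iio n) ≤ LinearMap.ker Λ := by
    rw [Submodule.span_le]
    rintro _ ⟨i, hi, rfl⟩
    exact h i hi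
  exact this hP'

lemma degree_leadingCoeff_qFac (hq0 : 0 < q) (j : ℕ) :
    (qFac (X : ℝ[X]) (C q) j).degree = j ∧
      (qFac (X : ℝ[X]) (C q) j).leadingCoeff = (-1) ^ j * q ^ j.choose 2 := by
  induction j with
  | zero => simp
  | succ j ih =>
    have e : (1 : ℝ[X]) - X * C q ^ j = C (-(q ^ j)) * X + C 1 := by
      rw [← C_pow, C_neg, C_1]; ring
    have h : -(q ^ j) ≠ 0 := neg_ne_zero.2 (by positivity)
    rw [qFac_succ, e, degree_mul, leadingCoeff_mul, ih.1, ih.2, degree_linear h,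
      leadingCoeff_linear h, Nat.choose_succ_succ' j 1, Nat.choose_one_right, pow_add, pow_succ]
    exact ⟨by push_cast; rfl, by ring⟩

/-- `massSum` as a linear functional. -/
noncomputable def massSumₗ (hq0 : 0 < q) (hq1 : q < 1) (ha : 0 < a) (haq : a * q < 1) :
    ℝ[X] →ₗ[ℝ] ℝ where
  toFun := massSum q a
  map_add' := massSum_add hq0 hq1 ha haq
  map_smul' c P := by rw [smul_eq_C_mul, massSum_C_mul]; rfl

lemma qFac_pow_self_inv (hq0 : 0 < q) (n : ℕ) : qFac (q ^ n) q⁻¹ n = qFac q q n := by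
  induction n with
  | zero => simp
  | succ n ih =>
    rw [qFac_succ', pow_succ, mul_inv_cancel_right₀ hq0.ne', ih, qFac_succ, mul_comm (q ^ n) q,
      mul_comm]

lemma massSum_mul_V_eq_zero (hq0 : 0 < q) (hq1 : q < 1) (ha : 0 < a) (haq : a * q < 1) {n : ℕ}
    {P : ℝ[X]} (hP : P.degree < n) : massSum q a (P * alSalamCarlitzV a q n) = 0 := by
  refine map_eq_zero_of_degree_lt (fun j => (degree_leadingCoeff_qFac hq0 j).1)
    ((massSumₗ hq0 hq1 ha haq).comp (LinearMap.mulRight ℝ (alSalamCarlitzV a q n))) (n := n) ?_ hP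
  intro j hj
  refine (massSum_qFac_mul_V hq0 hq1 ha haq n j).trans ?_
  have : qFac (q ^ j) q⁻¹ n = 0 := Finset.prod_eq_zero (Finset.mem_range.2 hj) (by
    have : q ^ j ≠ 0 := by positivity
    rw [inv_pow, mul_inv_cancel₀ this, sub_self])
  rw [this, mul_zero]

lemma massSum_V_mul_V (hq0 : 0 < q) (hq1 : q < 1) (ha : 0 < a) (haq : a * q < 1) {m n : ℕ}
    (h : m ≠ n) : massSum q a (alSalamCarlitzV a q m * alSalamCarlitzV a q n) = 0 := by
  rcases h.lt_or_gt with h | h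
  · exact massSum_mul_V_eq_zero hq0 hq1 ha haq (by rw [degree_alSalamCarlitzV]; exact_mod_cast h)
  · rw [mul_comm]
    exact massSum_mul_V_eq_zero hq0 hq1 ha haq (by rw [degree_alSalamCarlitzV]; exact_mod_cast h)

/-- The squared norm `a^n q^{-n²} (q;q)_n` of `V_n`. -/
noncomputable def alSalamCarlitzNorm (q a : ℝ) (n : ℕ) : ℝ :=
  a ^ n * (q ^ n ^ 2)⁻¹ * qFac q q n

lemma alSalamCarlitzNorm_pos (hq0 : 0 < q) (hq1 : q < 1) (ha : 0 < a) (n : ℕ) :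
    0 < alSalamCarlitzNorm q a n := by
  have := qFac_pos hq0 hq1 hq1 n
  unfold alSalamCarlitzNorm; positivity

lemma massSum_V_sq (hq0 : 0 < q) (hq1 : q < 1) (ha : 0 < a) (haq : a * q < 1) (n : ℕ) :
    massSum q a (alSalamCarlitzV a q n * alSalamCarlitzV a q n) = alSalamCarlitzNorm q a n := by
  obtain ⟨h1, h2⟩ := degree_leadingCoeff_qFac hq0 n
  -- One factor `V_n` may be replaced by a multiple of `(x;q)_n`, up to terms of lower degree.
  have hc : ((-1) ^ n * q ^ n.choose 2 : ℝ) ≠ 0 :=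
    mul_ne_zero (pow_ne_zero _ (by norm_num)) (by positivity)
  have hd : (C ((-1) ^ n * q ^ n.choose 2) * alSalamCarlitzV a q n
      - qFac (X : ℝ[X]) (C q) n).degree < n := by
    have hdeg : (C ((-1) ^ n * q ^ n.choose 2) * alSalamCarlitzV a q n).degree = n := by
      rw [degree_C_mul hc, degree_alSalamCarlitzV]
    have := degree_sub_lt_left (p := C ((-1) ^ n * q ^ n.choose 2) * alSalamCarlitzV a q n)
      (q := qFac (X : ℝ[X]) (C q) n) (hdeg.trans h1.symm)
      (by intro h; rw [h] at hdeg; simp at hdeg)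
      (by rw [leadingCoeff_mul, leadingCoeff_C,
            (monic_natDegree_alSalamCarlitzV a q n).1.leadingCoeff, mul_one, h2])
    rwa [hdeg] at this
  have h := massSum_mul_V_eq_zero hq0 hq1 ha haq hd
  rw [sub_mul, massSum_sub hq0 hq1 ha haq, mul_assoc, massSum_C_mul,
    massSum_qFac_mul_V hq0 hq1 ha haq, qFac_pow_self_inv hq0, sub_eq_zero] at h
  refine mul_left_cancel₀ hc (h.trans ?_)
  rw [alSalamCarlitzNorm, neg_pow a, sq, pow_mul]
  ring

lemma eval_one_alSalamCarlitzV (hq0 : 0 < q) (n : ℕ) :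
    (alSalamCarlitzV a q n).eval 1 = (-a) ^ n * (q ^ n.choose 2)⁻¹ := by
  induction n using Nat.twoStepInduction with
  | zero => simp [alSalamCarlitzV]
  | one => simp [alSalamCarlitzV]
  | more n ih0 ih1 =>
    have e1 : (n + 1).choose 2 = n + n.choose 2 := by
      rw [Nat.choose_succ_succ' n 1, Nat.choose_one_right]
    have e2 : (n + 2).choose 2 = n + 1 + (n + n.choose 2) := by
      rw [Nat.choose_succ_succ' (n + 1) 1, Nat.choose_one_right, e1]
    rw [alSalamCarlitzV]
    simp only [eval_sub, eval_mul, eval_X, eval_C]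
    rw [ih0, ih1, e2, e1, pow_add q (n + 1), pow_add q n (n.choose 2), pow_succ q n, pow_succ (-a) (n + 1),
      pow_succ (-a) n, show 2 * n + 1 = n + n + 1 by ring, pow_succ q (n + n), pow_add q n n]
    field_simp
    ring

/-- The normalised values `V_n(1)² / ‖V_n‖²` add up to the reciprocal of the mass at `1`: the
polynomials reach the point mass at `1`, which is the source of their completeness. -/
lemma hasSum_eval_one_sq (hq0 : 0 < q) (hq1 : q < 1) (ha : 0 < a) (haq : a * q < 1) :
    HasSum (fun n => (alSalamCarlitzV a q n).eval 1 ^ 2 / alSalamCarlitzNorm q a n)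
      (alSalamCarlitzMass q a 0)⁻¹ := by
  have hb : 0 ≤ a * q := by positivity
  have h1 := qPochInf_mul_qExpSum hq0 hq1 hb haq
  have h2 := qPochInf_mul_tsum_cauchyTerm hq0 hq1 ha haq
  have h3 : qExpSum q (a * q) = ∑' s, cauchyTerm q a s := by
    have := mul_left_cancel₀ (left_ne_zero_of_mul_eq_one h1) (h1.trans h2.symm)
    exact_mod_cast this
  have h4 : (alSalamCarlitzMass q a 0)⁻¹ = qExpSum q (a * q) := by
    rw [h3, alSalamCarlitzMass]; simp [cauchyTerm]
  rw [h4]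
  refine (summable_qExpSum hq0 hq1 hb haq).hasSum.congr_fun ?_
  intro n
  have p := (qFac_pos hq0 hq1 hq1 n).ne'
  rw [eval_one_alSalamCarlitzV hq0, alSalamCarlitzNorm, sq_eq_two_mul_choose_add n, mul_pow,
    pow_add, mul_pow, ← pow_mul, inv_pow, ← pow_mul, mul_comm n 2, pow_mul (-a) 2, neg_sq, ← pow_mul,
    two_mul n, pow_add, mul_comm (n.choose 2) 2]
  field_simp

end Orthogonality

/-! ### Orthogonality measures and the space `ℓ²` -/

section Measure
variable {q a : ℝ}

lemma integrable_eval {μ : Measure ℝ} (h : ∀ n : ℕ, Integrable (fun x : ℝ => x ^ n) μ)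
    (P : ℝ[X]) : Integrable (fun x => P.eval x) μ := by
  simp_rw [eval_eq_sum_range]
  exact integrable_finsetSum _ fun i _ => (h i).const_mul _

/-- The discrete measure with the masses `alSalamCarlitzMass q a m` at the points `q^{-m}`. -/
noncomputable def alSalamCarlitzMeasure (q a : ℝ) : Measure ℝ :=
  Measure.sum fun m : ℕ => ENNReal.ofReal (alSalamCarlitzMass q a m) • Measure.dirac ((q ^ m)⁻¹)

lemma integrable_eval_alSalamCarlitzMeasure (hq0 : 0 < q) (hq1 : q < 1) (ha : 0 < a)
    (haq : a * q < 1) (P : ℝ[X]) :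
    Integrable (fun x => P.eval x) (alSalamCarlitzMeasure q a) := by
  refine integrable_sum_dirac (fun m => ENNReal.ofReal_ne_top) ?_
  refine (summable_mass_mul_eval hq0 hq1 ha haq P).abs.congr fun m => ?_
  have := (alSalamCarlitzMass_pos hq0 hq1 ha haq m).le
  rw [ENNReal.toReal_ofReal this, abs_mul, abs_of_nonneg this, Real.norm_eq_abs]

lemma integral_eval_alSalamCarlitzMeasure (hq0 : 0 < q) (hq1 : q < 1) (ha : 0 < a)
    (haq : a * q < 1) (P : ℝ[X]) :
    ∫ x, P.eval x ∂(alSalamCarlitzMeasure q a) = massSum q a P := by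
  rw [alSalamCarlitzMeasure, integral_sum_dirac (fun m => ENNReal.ofReal_ne_top), massSum]
  congr 1; ext m
  rw [ENNReal.toReal_ofReal (alSalamCarlitzMass_pos hq0 hq1 ha haq m).le, smul_eq_mul]

lemma exists_isAlSalamCarlitzSystem (hq0 : 0 < q) (hq1 : q < 1) (ha : 0 < a) (haq : a * q < 1) :
    ∃ (μ : Measure ℝ) (p : ℕ → ℝ[X]), IsAlSalamCarlitzSystem a q μ p := by
  have hint := integral_eval_alSalamCarlitzMeasure hq0 hq1 ha haq
  have hc : ∀ n, 0 < (√(alSalamCarlitzNorm q a n))⁻¹ := fun n =>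
    inv_pos.2 (Real.sqrt_pos.2 (alSalamCarlitzNorm_pos hq0 hq1 ha n))
  refine ⟨alSalamCarlitzMeasure q a,
    fun n => C (√(alSalamCarlitzNorm q a n))⁻¹ * alSalamCarlitzV a q n, ?_, ?_, ?_⟩
  · refine HasSum.isProbabilityMeasure_sum_dirac
      (fun m => (alSalamCarlitzMass_pos hq0 hq1 ha haq m).le) ?_
    have h := (summable_mass_mul_eval hq0 hq1 ha haq 1).hasSum
    have h1 := massSum_one hq0 hq1 ha haq
    rw [massSum] at h1
    rw [h1] at h
    simpa using h
  · refine ⟨fun n => ?_, fun n => ?_, fun n => ?_, fun m n => ?_⟩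
    · simpa using integrable_eval_alSalamCarlitzMeasure hq0 hq1 ha haq (X ^ n)
    · rw [natDegree_C_mul (hc n).ne', (monic_natDegree_alSalamCarlitzV a q n).2]
    · rw [leadingCoeff_mul, leadingCoeff_C,
        (monic_natDegree_alSalamCarlitzV a q n).1.leadingCoeff, mul_one]
      exact hc n
    · simp_rw [← eval_mul]
      rw [hint, mul_mul_mul_comm, ← C_mul, massSum_C_mul]
      split_ifs with h
      · subst h
        have h1 := alSalamCarlitzNorm_pos hq0 hq1 ha m
        rw [massSum_V_sq hq0 hq1 ha haq, ← mul_inv, Real.mul_self_sqrt h1.le,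
          inv_mul_cancel₀ h1.ne']
      · rw [massSum_V_mul_V hq0 hq1 ha haq h, mul_zero]
  · intro m n h
    simp_rw [← eval_mul]
    rw [hint, massSum_V_mul_V hq0 hq1 ha haq h]

/-- All measures that make the `V_n` orthogonal have the same moments. -/
lemma IsAlSalamCarlitzSystem.integral_eval (hq0 : 0 < q) (hq1 : q < 1) (ha : 0 < a)
    (haq : a * q < 1) {μ : Measure ℝ} {p : ℕ → ℝ[X]} (h : IsAlSalamCarlitzSystem a q μ p)
    (P : ℝ[X]) : ∫ x, P.eval x ∂μ = massSum q a P := by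
  have := h.isProbabilityMeasure
  have hi := integrable_eval h.orthonormal.integrable_pow
  let I : ℝ[X] →ₗ[ℝ] ℝ :=
    { toFun := fun P => ∫ x, P.eval x ∂μ
      map_add' := fun P Q => by
        simp only [eval_add]; exact integral_add (hi P) (hi Q)
      map_smul' := fun c P => by simp [integral_const_mul] }
  have h0 : (I - massSumₗ hq0 hq1 ha haq) P = 0 := by
    refine map_eq_zero_of_degree_lt (degree_alSalamCarlitzV a q) _ (n := P.natDegree + 1) ?_
      (lt_of_le_of_lt degree_le_natDegree (by exact_mod_cast Nat.lt_succ_self _))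
    intro n _
    have e : ∀ n, alSalamCarlitzV a q n = alSalamCarlitzV a q 0 * alSalamCarlitzV a q n :=
      fun n => by simp [alSalamCarlitzV]
    change ∫ x, (alSalamCarlitzV a q n).eval x ∂μ - massSum q a (alSalamCarlitzV a q n) = 0
    rcases eq_or_ne 0 n with rfl | hn
    · simp [alSalamCarlitzV, massSum_one hq0 hq1 ha haq]
    · rw [e n, massSum_V_mul_V hq0 hq1 ha haq hn]
      simp_rw [eval_mul]
      rw [h.orthogonal 0 n hn, sub_zero]
  exact sub_eq_zero.1 h0

end Measure

section Completeness
variable {q a : ℝ}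

/-- An orthonormal sequence for which Bessel's inequality at `e` is an equality has `e` in its
closed span: `e` is orthogonal to everything that is orthogonal to the sequence. -/
lemma Orthonormal.inner_eq_zero_of_hasSum {E : Type*} [NormedAddCommGroup E]
    [InnerProductSpace ℂ E] {u : ℕ → E} (hu : Orthonormal ℂ u) {e f : E}
    (he : HasSum (fun n => ‖inner ℂ (u n) e‖ ^ 2) (‖e‖ ^ 2)) (hf : ∀ n, inner ℂ (u n) f = 0) :
    inner ℂ e f = 0 := by
  -- Bessel's inequality shows that `e` has minimal norm in `e + ℂ f`.
  have key : ∀ c : ℂ, ‖e‖ ^ 2 ≤ ‖e - c • f‖ ^ 2 := by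
    intro c
    have h := hu.tsum_inner_products_le (e - c • f)
    simp only [inner_sub_right, inner_smul_right, hf, mul_zero, sub_zero] at h
    rwa [he.tsum_eq] at h
  set z := inner ℂ e f with hz
  set t : ℝ := (‖f‖ ^ 2 + 1)⁻¹ with ht
  have hpos : 0 < ‖f‖ ^ 2 + 1 := by positivity
  have h := key ((t : ℂ) * (starRingEnd ℂ) z)
  have hre : RCLike.re (inner ℂ e (((t : ℂ) * (starRingEnd ℂ) z) • f)) = t * ‖z‖ ^ 2 := by
    rw [inner_smul_right, ← hz, mul_assoc, Complex.conj_mul']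
    norm_cast
  rw [norm_sub_sq (𝕜 := ℂ), hre, norm_smul, norm_mul, RCLike.norm_conj, Complex.norm_real,
    Real.norm_of_nonneg (by positivity)] at h
  have h2 : t * ‖f‖ ^ 2 ≤ 1 := by rw [ht, inv_mul_le_iff₀ hpos]; linarith
  have ht0 : 0 < t := by positivity
  have h3 : 0 ≤ t * ‖z‖ ^ 2 * (t * ‖f‖ ^ 2 - 2) := by nlinarith
  have h4 : t * ‖z‖ ^ 2 ≤ 0 := by nlinarith [mul_nonneg ht0.le (sq_nonneg ‖z‖)]
  have h5 : ‖z‖ ^ 2 ≤ 0 := by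
    by_contra hcon
    push Not at hcon
    nlinarith [mul_pos ht0 hcon]
  exact norm_eq_zero.1 (pow_eq_zero_iff two_ne_zero |>.1 (le_antisymm h5 (sq_nonneg _)))

lemma memℓp_two_of_summable {g : ℕ → ℂ} (h : Summable fun m => ‖g m‖ ^ 2) :
    Memℓp g 2 := by
  refine memℓp_gen ?_
  simpa using h

/-- A polynomial as an element of `ℓ²`: its values at the points `q^{-m}`, scaled by the square
roots of the masses, so that inner products become integrals of products. -/
noncomputable def polyVec (hq0 : 0 < q) (hq1 : q < 1) (ha : 0 < a) (haq : a * q < 1) (P : ℝ[X]) :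
    lp (fun _ : ℕ => ℂ) 2 :=
  ⟨fun m => ((√(alSalamCarlitzMass q a m) * P.eval (q ^ m)⁻¹ : ℝ) : ℂ), memℓp_two_of_summable <| by
    refine (summable_mass_mul_eval hq0 hq1 ha haq (P * P)).congr fun m => ?_
    rw [Complex.norm_real, Real.norm_eq_abs, sq_abs, mul_pow,
      Real.sq_sqrt (alSalamCarlitzMass_pos hq0 hq1 ha haq m).le, eval_mul, sq]⟩

variable {hq0 : 0 < q} {hq1 : q < 1} {ha : 0 < a} {haq : a * q < 1}

lemma hasSum_inner_polyVec (P : ℝ[X]) (g : lp (fun _ : ℕ => ℂ) 2) :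
    HasSum (fun m => ((√(alSalamCarlitzMass q a m) * P.eval (q ^ m)⁻¹ : ℝ) : ℂ) * g m)
      (inner ℂ (polyVec hq0 hq1 ha haq P) g) := by
  refine (lp.hasSum_inner (𝕜 := ℂ) (polyVec hq0 hq1 ha haq P) g).congr_fun fun m => ?_
  rw [RCLike.inner_apply', polyVec]
  simp only [Complex.conj_ofReal]

lemma inner_polyVec_polyVec (P Q : ℝ[X]) :
    inner ℂ (polyVec hq0 hq1 ha haq P) (polyVec hq0 hq1 ha haq Q) =
      ((massSum q a (P * Q) : ℝ) : ℂ) := by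
  refine (hasSum_inner_polyVec P _).unique ?_
  have h := (summable_mass_mul_eval hq0 hq1 ha haq (P * Q)).hasSum
  refine (Complex.hasSum_ofReal.2 h).congr_fun fun m => ?_
  have e := Real.mul_self_sqrt (alSalamCarlitzMass_pos hq0 hq1 ha haq m).le
  rw [polyVec]
  simp only
  rw [← Complex.ofReal_mul, Complex.ofReal_inj, eval_mul]
  linear_combination (P.eval (q ^ m)⁻¹ * Q.eval (q ^ m)⁻¹) * e

end Completeness

/-! ### Completeness of the polynomials -/

section Completeness
variable {q a : ℝ} {hq0 : 0 < q} {hq1 : q < 1} {ha : 0 < a} {haq : a * q < 1}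

lemma inner_polyVec_add (P Q : ℝ[X]) (g : lp (fun _ : ℕ => ℂ) 2) :
    inner ℂ (polyVec hq0 hq1 ha haq (P + Q)) g =
      inner ℂ (polyVec hq0 hq1 ha haq P) g + inner ℂ (polyVec hq0 hq1 ha haq Q) g := by
  refine (hasSum_inner_polyVec _ g).unique
    (((hasSum_inner_polyVec P g).add (hasSum_inner_polyVec Q g)).congr_fun fun m => ?_)
  rw [eval_add]; push_cast; ring

lemma inner_polyVec_C_mul (c : ℝ) (P : ℝ[X]) (g : lp (fun _ : ℕ => ℂ) 2) :
    inner ℂ (polyVec hq0 hq1 ha haq (C c * P)) g = c * inner ℂ (polyVec hq0 hq1 ha haq P) g := by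
  refine (hasSum_inner_polyVec _ g).unique
    (((hasSum_inner_polyVec P g).mul_left (c : ℂ)).congr_fun fun m => ?_)
  rw [eval_mul, eval_C]; push_cast; ring

/-- A sequence orthogonal to all polynomials vanishes at the node `1`, because the point mass there
is a limit of polynomials. -/
lemma apply_zero_eq_zero_of_inner_polyVec {g : lp (fun _ : ℕ => ℂ) 2}
    (hg : ∀ P, inner ℂ (polyVec hq0 hq1 ha haq P) g = 0) : g 0 = 0 := by
  set u : ℕ → lp (fun _ : ℕ => ℂ) 2 := fun n =>
    polyVec hq0 hq1 ha haq (C (√(alSalamCarlitzNorm q a n))⁻¹ * alSalamCarlitzV a q n) with hu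
  have hn := alSalamCarlitzNorm_pos hq0 hq1 ha
  have ho : Orthonormal ℂ u := by
    rw [orthonormal_iff_ite]
    intro m n
    rw [hu]
    simp only
    rw [inner_polyVec_polyVec, mul_mul_mul_comm, ← C_mul, massSum_C_mul]
    split_ifs with h
    · subst h
      rw [massSum_V_sq hq0 hq1 ha haq, ← mul_inv, Real.mul_self_sqrt (hn m).le,
        inv_mul_cancel₀ (hn m).ne']
      simp
    · rw [massSum_V_mul_V hq0 hq1 ha haq h]; simp
  have hm0 := alSalamCarlitzMass_pos hq0 hq1 ha haq 0
  have he : HasSum (fun n => ‖inner ℂ (u n) (lp.single 2 (0 : ℕ) (1 : ℂ))‖ ^ 2)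
      (‖(lp.single 2 (0 : ℕ) (1 : ℂ) : lp (fun _ : ℕ => ℂ) 2)‖ ^ 2) := by
    have h := (hasSum_eval_one_sq hq0 hq1 ha haq).mul_left (alSalamCarlitzMass q a 0)
    rw [mul_inv_cancel₀ hm0.ne'] at h
    rw [lp.norm_single (by norm_num), norm_one, one_pow]
    refine h.congr_fun fun n => ?_
    rw [lp.inner_single_right, RCLike.inner_apply', mul_one, RCLike.norm_conj]
    simp only [hu, polyVec]
    rw [Complex.norm_real, Real.norm_eq_abs, sq_abs, mul_pow, Real.sq_sqrt hm0.le, eval_mul, eval_C,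
      mul_pow, inv_pow, Real.sq_sqrt (hn n).le, pow_zero, inv_one]
    ring
  have := ho.inner_eq_zero_of_hasSum he (fun n => hg _)
  rw [lp.inner_single_left, RCLike.inner_apply'] at this
  simpa using this

lemma node_sub_one_pos (hq0 : 0 < q) (hq1 : q < 1) {m : ℕ} (hm : m ≠ 0) :
    0 < (q ^ m)⁻¹ - 1 :=
  sub_pos.2 ((one_lt_inv₀ (pow_pos hq0 m)).2 (pow_lt_one₀ hq0.le hq1 hm))

/-- The orthogonality to all polynomials survives the division by `x - 1`. At the node `1` itself the
quotient is `0 / 0 = 0`. -/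
lemma exists_div_inner_polyVec_eq_zero {g : lp (fun _ : ℕ => ℂ) 2}
    (hg : ∀ P, inner ℂ (polyVec hq0 hq1 ha haq P) g = 0) :
    ∃ h : lp (fun _ : ℕ => ℂ) 2, (∀ m, h m = g m / (((q ^ m)⁻¹ - 1 : ℝ) : ℂ)) ∧
      ∀ P, inner ℂ (polyVec hq0 hq1 ha haq P) h = 0 := by
  have hg0 := apply_zero_eq_zero_of_inner_polyVec hg
  have hd : 0 < q⁻¹ - 1 := by simpa using node_sub_one_pos hq0 hq1 one_ne_zero
  have hle : ∀ m, ‖g m / (((q ^ m)⁻¹ - 1 : ℝ) : ℂ)‖ ≤ ‖g m‖ * (q⁻¹ - 1)⁻¹ := by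
    intro m
    rcases eq_or_ne m 0 with rfl | hm
    · simp [hg0]
    · have h1 := node_sub_one_pos hq0 hq1 hm
      have h2 : q⁻¹ ≤ (q ^ m)⁻¹ := by
        rw [inv_le_inv₀ hq0 (by positivity)]
        exact pow_le_of_le_one hq0.le hq1.le hm
      rw [norm_div, Complex.norm_real, Real.norm_of_nonneg h1.le, div_eq_mul_inv]
      gcongr
  have hs : Summable fun m => ‖g m‖ ^ 2 := by
    have := (lp.memℓp g).summable (by norm_num)
    simpa using this
  let h : lp (fun _ : ℕ => ℂ) 2 := ⟨fun m => g m / (((q ^ m)⁻¹ - 1 : ℝ) : ℂ),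
    memℓp_two_of_summable <| by
      refine Summable.of_nonneg_of_le (fun m => by positivity) (fun m => ?_)
        (hs.mul_right ((q⁻¹ - 1)⁻¹ ^ 2))
      rw [← mul_pow]
      exact pow_le_pow_left₀ (norm_nonneg _) (hle m) 2⟩
  have hh : ∀ m, h m = g m / (((q ^ m)⁻¹ - 1 : ℝ) : ℂ) := fun m => rfl
  -- The multiples of `x - 1` are orthogonal to `h`; a multiple of the point mass at `1`, where
  -- `x - 1` vanishes, is added to reach orthogonality to the constants as well.
  have hm0 := alSalamCarlitzMass_pos hq0 hq1 ha haq 0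
  have hsm : (√(alSalamCarlitzMass q a 0) : ℂ) ≠ 0 := by
    exact_mod_cast (Real.sqrt_pos.2 hm0).ne'
  set c : ℂ := -inner ℂ (polyVec hq0 hq1 ha haq 1) h / √(alSalamCarlitzMass q a 0) with hc
  set k := h + lp.single 2 (0 : ℕ) c with hk
  have hsingle : ∀ P, inner ℂ (polyVec hq0 hq1 ha haq P) (lp.single 2 (0 : ℕ) c) =
      √(alSalamCarlitzMass q a 0) * P.eval 1 * c := by
    intro P
    rw [lp.inner_single_right, RCLike.inner_apply', polyVec]
    simp
  have hk1 : inner ℂ (polyVec hq0 hq1 ha haq 1) k = 0 := by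
    rw [hk, inner_add_right, hsingle, hc, eval_one]
    push_cast
    field_simp
    ring
  have hkX : ∀ Q : ℝ[X], inner ℂ (polyVec hq0 hq1 ha haq ((X - C 1) * Q)) k = 0 := by
    intro Q
    rw [hk, inner_add_right, hsingle]
    have e : inner ℂ (polyVec hq0 hq1 ha haq ((X - C 1) * Q)) h =
        inner ℂ (polyVec hq0 hq1 ha haq Q) g := by
      refine (hasSum_inner_polyVec _ h).unique ((hasSum_inner_polyVec Q g).congr_fun fun m => ?_)
      rcases eq_or_ne m 0 with rfl | hm
      · simp [hg0, hh]
      · have h1 : (((q ^ m)⁻¹ - 1 : ℝ) : ℂ) ≠ 0 := by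
          exact_mod_cast (node_sub_one_pos hq0 hq1 hm).ne'
        rw [hh, eval_mul, eval_sub, eval_X, eval_C]
        generalize (q ^ m)⁻¹ - 1 = d at h1
        push_cast
        field_simp
    rw [e, hg]
    simp
  have hkall : ∀ P, inner ℂ (polyVec hq0 hq1 ha haq P) k = 0 := by
    intro P
    have e : P = C (P.eval 1) * 1 + (X - C 1) * (P /ₘ (X - C 1)) := by
      rw [mul_one, ← modByMonic_X_sub_C_eq_C_eval, modByMonic_add_div]
    rw [e, inner_polyVec_add, inner_polyVec_C_mul, hk1, hkX, mul_zero, add_zero]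
  have hk0 := apply_zero_eq_zero_of_inner_polyVec hkall
  have hc0 : c = 0 := by
    have : k 0 = h 0 + c := by
      rw [hk, lp.coeFn_add, Pi.add_apply, lp.single_apply_self]
    rw [hk0, hh, hg0, zero_div, zero_add] at this
    exact this.symm
  have hkh : k = h := by rw [hk, hc0, lp.single_zero, add_zero]
  exact ⟨h, hh, fun P => hkh ▸ hkall P⟩

/-- The polynomials are complete for the discrete measure. -/
theorem eq_zero_of_inner_polyVec_eq_zero {f : lp (fun _ : ℕ => ℂ) 2}
    (hf : ∀ P, inner ℂ (polyVec hq0 hq1 ha haq P) f = 0) : f = 0 := by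
  have hpow : ∀ n : ℕ, ∃ h : lp (fun _ : ℕ => ℂ) 2,
      (∀ m, h m = f m / (((q ^ m)⁻¹ - 1 : ℝ) : ℂ) ^ n) ∧
      ∀ P, inner ℂ (polyVec hq0 hq1 ha haq P) h = 0 := by
    intro n
    induction n with
    | zero => exact ⟨f, by simp, hf⟩
    | succ n ih =>
      obtain ⟨g, hg1, hg2⟩ := ih
      obtain ⟨h, hh1, hh2⟩ := exists_div_inner_polyVec_eq_zero hg2
      exact ⟨h, fun m => by rw [hh1, hg1, pow_succ, div_div], hh2⟩
  set w : ℕ → ℂ := fun m => √(alSalamCarlitzMass q a m) * f m with hw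
  have hws : Summable w := by
    have := (hasSum_inner_polyVec (hq0 := hq0) (hq1 := hq1) (ha := ha) (haq := haq) 1 f).summable
    simpa [hw] using this
  have hsum : ∀ n : ℕ, ∑' m, w m / (((q ^ m)⁻¹ - 1 : ℝ) : ℂ) ^ n = 0 := by
    intro n
    obtain ⟨h, h1, h2⟩ := hpow n
    have := (hasSum_inner_polyVec (hq0 := hq0) (hq1 := hq1) (ha := ha) (haq := haq) 1 h).tsum_eq
    rw [h2] at this
    rw [← this]
    congr 1; ext m
    rw [h1, eval_one, mul_one, hw]
    ring
  have hf0 := apply_zero_eq_zero_of_inner_polyVec hf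
  -- After multiplication by `(q^{-m} - 1)^n` the term at the first node with `w ≠ 0` dominates.
  have hall : ∀ m, w m = 0 := by
    intro m
    induction m using Nat.strong_induction_on with
    | _ m ih =>
    rcases eq_or_ne m 0 with rfl | hm
    · simp [hw, hf0]
    have hdm := node_sub_one_pos hq0 hq1 hm
    set r : ℕ → ℝ := fun k => ((q ^ m)⁻¹ - 1) / ((q ^ k)⁻¹ - 1) with hr
    have hr0 : ∀ k, m ≤ k → 0 ≤ r k := fun k hk =>
      div_nonneg hdm.le (node_sub_one_pos hq0 hq1 (by omega)).le
    have hr1 : ∀ k, m < k → r k < 1 := fun k hk => by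
      rw [hr, div_lt_one (node_sub_one_pos hq0 hq1 (by omega))]
      have := (inv_lt_inv₀ (pow_pos hq0 m) (pow_pos hq0 k)).2
        (pow_lt_pow_right_of_lt_one₀ hq0 hq1 hk)
      linarith
    have hrm : r m = 1 := div_self hdm.ne'
    have hT := tendsto_tsum_of_dominated_convergence (𝓕 := atTop)
      (f := fun (n : ℕ) k => w k * (r k : ℂ) ^ n) (g := fun k => if k = m then w m else 0)
      (bound := fun k => ‖w k‖) hws.norm (fun k => by
        rcases lt_trichotomy k m with hk | hk | hk
        · simp [ih k hk, hk.ne]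
        · subst hk; simp [hrm]
        · rw [if_neg hk.ne']
          have : ‖(r k : ℂ)‖ < 1 := by
            rw [Complex.norm_real, Real.norm_of_nonneg (hr0 k hk.le)]; exact hr1 k hk
          simpa using (tendsto_pow_atTop_nhds_zero_of_norm_lt_one this).const_mul (w k))
      (Eventually.of_forall fun n k => by
        rcases lt_or_ge k m with hk | hk
        · simp [ih k hk]
        · rw [norm_mul, norm_pow, Complex.norm_real, Real.norm_of_nonneg (hr0 k hk)]
          refine mul_le_of_le_one_right (norm_nonneg _) (pow_le_one₀ (hr0 k hk) ?_)
          rcases hk.eq_or_lt with rfl | hk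
          · exact hrm.le
          · exact (hr1 k hk).le)
    have hz : ∀ n : ℕ, ∑' k, w k * (r k : ℂ) ^ n = 0 := by
      intro n
      have : ∀ k, w k * (r k : ℂ) ^ n =
          (((q ^ m)⁻¹ - 1 : ℝ) : ℂ) ^ n * (w k / (((q ^ k)⁻¹ - 1 : ℝ) : ℂ) ^ n) := by
        intro k
        rw [hr, Complex.ofReal_div, div_pow]; ring
      simp_rw [this]
      rw [tsum_mul_left, hsum, mul_zero]
    simp only [hz, tsum_ite_eq] at hT
    exact (tendsto_nhds_unique hT tendsto_const_nhds)
  ext m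
  have hsm : (√(alSalamCarlitzMass q a m) : ℂ) ≠ 0 := by
    exact_mod_cast (Real.sqrt_pos.2 (alSalamCarlitzMass_pos hq0 hq1 ha haq m)).ne'
  simpa [hw, hsm] using hall m

end Completeness

/-! ### Parseval's identity and the series for `ρ₀` -/

section Parseval
variable {q a : ℝ}

/-- The coefficient of `‖qPochInfOmit q m x‖²` in the series for `∑ |p_k(x)|²`. -/
noncomputable def parsevalCoeff (q a : ℝ) (m : ℕ) : ℝ :=
  (∑' s, cauchyTerm q a s) / ‖qPochInf q q‖ ^ 2 * (qFac (a * q) q m / qFac q q m) * (q / a) ^ m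

lemma norm_lagrangeFun_sq_div_mass (hq0 : 0 < q) (hq1 : q < 1) (ha : 0 < a) (haq : a * q < 1)
    (m : ℕ) (x : ℂ) : ‖lagrangeFun q m x‖ ^ 2 / alSalamCarlitzMass q a m =
      parsevalCoeff q a m * ‖qPochInfOmit q m x‖ ^ 2 := by
  have hZ := (tsum_cauchyTerm_pos hq0 hq1 ha haq).ne'
  have h1 := qFac_pos hq0 hq1 hq1 m
  have h2 := (qFac_pos hq0 hq1 haq m).ne'
  have h3 : ‖qPochInf q q‖ ≠ 0 := norm_ne_zero_iff.2 (qPochInf_self_ne_zero hq0 hq1)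
  have e : ‖(q : ℂ)‖ = q := by simp [abs_of_pos hq0]
  have e1 : ‖qFac (q : ℂ) q m‖ = qFac q q m := by
    rw [← ofReal_qFac, Complex.norm_real, Real.norm_of_nonneg h1.le]
  have e2 : (q ^ (m + 1).choose 2) ^ 2 = q ^ m ^ 2 * q ^ m := by
    rw [← pow_mul, ← pow_add]
    congr 1
    have := sq_eq_two_mul_choose_add m
    have e3 : (m + 1).choose 2 = m + m.choose 2 := by
      rw [Nat.choose_succ_succ' m 1, Nat.choose_one_right]
    omega
  rw [lagrangeFun, alSalamCarlitzMass, parsevalCoeff, cauchyTerm]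
  simp only [norm_mul, norm_div, norm_pow, norm_neg, norm_one, one_pow, one_mul, e, e1, mul_pow,
    div_pow, e2]
  have h1' := h1.ne'
  field_simp

lemma summable_parsevalCoeff (hq0 : 0 < q) (hq1 : q < 1) (hqa : q < a) (haq : a * q < 1) :
    Summable (parsevalCoeff q a) := by
  have ha : 0 < a := hq0.trans hqa
  have hr : q / a < 1 := (div_lt_one ha).2 hqa
  have hZ := tsum_cauchyTerm_pos hq0 hq1 ha haq
  have hE := one_le_qExpSum hq0 hq1 hq0.le hq1
  refine Summable.of_nonneg_of_le (fun m => ?_) (fun m => ?_)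
    ((summable_geometric_of_lt_one (by positivity) hr).mul_left
      ((∑' s, cauchyTerm q a s) / ‖qPochInf q q‖ ^ 2 * qExpSum q q))
  · have h1 := qFac_pos hq0 hq1 hq1 m
    have h2 := qFac_pos hq0 hq1 haq m
    unfold parsevalCoeff; positivity
  · have h1 := qFac_pos hq0 hq1 hq1 m
    have h2 : qFac (a * q) q m ≤ 1 := Finset.prod_le_one
      (fun k _ => (sub_pos.2 (mul_pow_lt_one hq0 hq1 haq k)).le)
      (fun k _ => sub_le_self _ (by positivity))
    have h3 : qFac (a * q) q m / qFac q q m ≤ qExpSum q q := by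
      rw [div_le_iff₀ h1]
      have h4 := inv_qExpSum_le_qFac hq0 hq1 hq0.le hq1 m
      rw [inv_le_iff_one_le_mul₀ (by linarith)] at h4
      linarith
    unfold parsevalCoeff
    gcongr

lemma parsevalCoeff_nonneg (hq0 : 0 < q) (hq1 : q < 1) (ha : 0 < a) (haq : a * q < 1) (m : ℕ) :
    0 ≤ parsevalCoeff q a m := by
  have hZ := tsum_cauchyTerm_pos hq0 hq1 ha haq
  have h1 := qFac_pos hq0 hq1 hq1 m
  have h2 := qFac_pos hq0 hq1 haq m
  unfold parsevalCoeff; positivity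

lemma norm_qPochInf_mul_pow_le (hq0 : 0 < q) (hq1 : q < 1) (x : ℂ) (m : ℕ) :
    ‖qPochInf (x * (q : ℂ) ^ m) q‖ ≤ Real.exp (‖x‖ * (1 - q)⁻¹) :=
  le_of_tendsto (tendsto_qFac (norm_ofReal_lt_one hq0 hq1) _).norm
    (Eventually.of_forall fun n => norm_qFac_mul_pow_le hq0 hq1 x m n)

lemma norm_qPochInfOmit_le (hq0 : 0 < q) (hq1 : q < 1) (m : ℕ) (x : ℂ) :
    ‖qPochInfOmit q m x‖ ≤ Real.exp (‖x‖ * (1 - q)⁻¹) * Real.exp (‖x‖ * (1 - q)⁻¹) := by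
  rw [qPochInfOmit, norm_mul]
  gcongr
  · simpa using norm_qFac_mul_pow_le hq0 hq1 x 0 m
  · exact norm_qPochInf_mul_pow_le hq0 hq1 x (m + 1)

lemma parsevalCoeff_mul_norm_sq_le (hq0 : 0 < q) (hq1 : q < 1) (ha : 0 < a) (haq : a * q < 1)
    (m : ℕ) (x : ℂ) : ‖parsevalCoeff q a m * ‖qPochInfOmit q m x‖ ^ 2‖ ≤ parsevalCoeff q a m *
      (Real.exp (‖x‖ * (1 - q)⁻¹) * Real.exp (‖x‖ * (1 - q)⁻¹)) ^ 2 := by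
  have h := parsevalCoeff_nonneg hq0 hq1 ha haq m
  rw [Real.norm_of_nonneg (by positivity)]
  have := norm_qPochInfOmit_le hq0 hq1 m x
  gcongr

/-- Parseval's identity for the orthonormal polynomials and the interpolation functions: at every
point `x`, `∑ |p_k(x)|² = ∑ |lagrangeFun q m x|² / mass m`. -/
theorem IsAlSalamCarlitzSystem.hasSum_norm_sq (hq0 : 0 < q) (hq1 : q < 1) (hqa : q < a)
    (haq : a * q < 1) {μ : Measure ℝ} {p : ℕ → ℝ[X]} (h : IsAlSalamCarlitzSystem a q μ p) (x : ℂ) :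
    HasSum (fun k => ‖aeval x (p k)‖ ^ 2)
      (∑' m, parsevalCoeff q a m * ‖qPochInfOmit q m x‖ ^ 2) := by
  have ha : 0 < a := hq0.trans hqa
  have hmass := alSalamCarlitzMass_pos hq0 hq1 ha haq
  have hsq : ∀ m, ‖lagrangeFun q m x / √(alSalamCarlitzMass q a m)‖ ^ 2 =
      parsevalCoeff q a m * ‖qPochInfOmit q m x‖ ^ 2 := by
    intro m
    rw [← norm_lagrangeFun_sq_div_mass hq0 hq1 ha haq, norm_div, div_pow, Complex.norm_real,
      Real.norm_eq_abs, sq_abs, Real.sq_sqrt (hmass m).le]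
  have hsum : Summable fun m => parsevalCoeff q a m * ‖qPochInfOmit q m x‖ ^ 2 :=
    ((summable_parsevalCoeff hq0 hq1 hqa haq).mul_right _).of_norm_bounded
      fun m => parsevalCoeff_mul_norm_sq_le hq0 hq1 ha haq m x
  -- By the interpolation series, the coefficients of `G` along polynomials are their values at `x`.
  let G : lp (fun _ : ℕ => ℂ) 2 := ⟨fun m => lagrangeFun q m x / √(alSalamCarlitzMass q a m),
    memℓp_two_of_summable (hsum.congr fun m => (hsq m).symm)⟩
  have hG : ∀ P : ℝ[X], inner ℂ (polyVec hq0 hq1 ha haq P) G = aeval x P := by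
    intro P
    refine (hasSum_inner_polyVec P G).unique
      ((hasSum_eval_mul_lagrangeFun hq0 hq1 P x).congr_fun fun m => ?_)
    have : (√(alSalamCarlitzMass q a m) : ℂ) ≠ 0 := by
      exact_mod_cast (Real.sqrt_pos.2 (hmass m)).ne'
    change _ * (lagrangeFun q m x / √(alSalamCarlitzMass q a m)) = _
    push_cast
    field_simp
  set u : ℕ → lp (fun _ : ℕ => ℂ) 2 := fun k => polyVec hq0 hq1 ha haq (p k) with hu
  have ho : Orthonormal ℂ u := by
    rw [orthonormal_iff_ite]
    intro m n
    rw [hu]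
    simp only
    rw [inner_polyVec_polyVec, ← h.integral_eval hq0 hq1 ha haq]
    simp_rw [eval_mul]
    rw [h.orthonormal.integral_mul]
    split_ifs <;> simp
  have hdeg : ∀ k, (p k).degree = k := fun k => by
    have := h.orthonormal.leadingCoeff_pos k
    rw [degree_eq_natDegree (by intro h0; simp [h0] at this), h.orthonormal.natDegree_eq]
  have hbot : (Submodule.span ℂ (Set.range u))ᗮ = ⊥ := by
    rw [Submodule.eq_bot_iff]
    intro f hf
    have hf' : ∀ k, inner ℂ (u k) f = 0 := fun k =>
      hf (u k) (Submodule.subset_span ⟨k, rfl⟩)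
    refine eq_zero_of_inner_polyVec_eq_zero (hq0 := hq0) (hq1 := hq1) (ha := ha) (haq := haq)
      fun P => ?_
    let S : Polynomial.Sequence ℝ := ⟨p, hdeg⟩
    have hP : P ∈ Submodule.span ℝ (Set.range S) := by
      rw [S.span fun i => (leadingCoeff_ne_zero.2 (S.ne_zero i)).isUnit]; trivial
    induction hP using Submodule.span_induction with
    | mem _ hx => obtain ⟨k, rfl⟩ := hx; exact hf' k
    | zero => simpa using inner_polyVec_C_mul (hq0 := hq0) (hq1 := hq1) (ha := ha) (haq := haq) 0 0 f
    | add P Q _ _ h1 h2 => rw [inner_polyVec_add, h1, h2, add_zero]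
    | smul c P _ h1 => rw [smul_eq_C_mul, inner_polyVec_C_mul, h1, mul_zero]
  let b := HilbertBasis.mkOfOrthogonalEqBot ho hbot
  have hb : ∀ k, b k = u k := fun k => by
    rw [HilbertBasis.coe_mkOfOrthogonalEqBot]
  have hP := b.hasSum_inner_mul_inner G G
  have hGG : inner ℂ G G = ((∑' m, parsevalCoeff q a m * ‖qPochInfOmit q m x‖ ^ 2 : ℝ) : ℂ) := by
    refine (lp.hasSum_inner (𝕜 := ℂ) G G).unique
      ((Complex.hasSum_ofReal.2 hsum.hasSum).congr_fun fun m => ?_)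
    rw [← hsq, inner_self_eq_norm_sq_to_K]
    norm_cast
  rw [hGG] at hP
  refine Complex.hasSum_ofReal.1 (hP.congr_fun fun k => ?_)
  rw [hb, ← inner_conj_symm G (u k), hG, Complex.conj_mul']
  norm_cast

end Parseval

section Mean
variable {q a : ℝ}

lemma norm_circlePt (θ : ℝ) : ‖circlePt θ‖ = 1 := Complex.norm_exp_ofReal_mul_I θ

lemma circlePt_ne_zero (θ : ℝ) : circlePt θ ≠ 0 := Complex.exp_ne_zero _

lemma continuous_circlePt : Continuous circlePt := by unfold circlePt; fun_prop

lemma one_div_circlePt (θ : ℝ) : 1 / circlePt θ = (starRingEnd ℂ) (circlePt θ) := by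
  rw [one_div, Complex.inv_def, Complex.normSq_eq_norm_sq, norm_circlePt]; simp

lemma circlePt_ne_one_ae : ∀ᵐ θ ∂(volume : Measure ℝ), circlePt θ ≠ 1 := by
  have hc : {θ : ℝ | circlePt θ = 1}.Countable := by
    refine (Set.countable_range fun n : ℤ => (n : ℝ) * (2 * Real.pi)).mono fun θ hθ => ?_
    obtain ⟨n, hn⟩ := Complex.exp_eq_one_iff.1 hθ
    refine ⟨n, ?_⟩
    have h4 : (θ : ℂ) = n * (2 * Real.pi) :=
      mul_right_cancel₀ Complex.I_ne_zero (hn.trans (by ring))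
    exact_mod_cast h4.symm
  exact hc.ae_notMem volume

lemma continuous_qPochInfOmit (hq0 : 0 < q) (hq1 : q < 1) (m : ℕ) :
    Continuous (qPochInfOmit q m) := by
  have h := continuous_qPochInf (norm_ofReal_lt_one hq0 hq1)
  unfold qPochInfOmit qFac
  exact (by fun_prop : Continuous _).mul (h.comp (by fun_prop))

lemma conj_qFac (q : ℝ) (z : ℂ) (n : ℕ) :
    (starRingEnd ℂ) (qFac z q n) = qFac ((starRingEnd ℂ) z) q n := by
  simp [qFac, map_prod]

lemma conj_qPochInf (hq0 : 0 < q) (hq1 : q < 1) (z : ℂ) :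
    (starRingEnd ℂ) (qPochInf z q) = qPochInf ((starRingEnd ℂ) z) q := by
  have hq := norm_ofReal_lt_one hq0 hq1
  refine tendsto_nhds_unique ((Complex.continuous_conj.tendsto _).comp (tendsto_qFac hq z)) ?_
  simpa [Function.comp_def, conj_qFac] using tendsto_qFac hq ((starRingEnd ℂ) z)

lemma conj_qPochInfOmit (hq0 : 0 < q) (hq1 : q < 1) (m : ℕ) (z : ℂ) :
    (starRingEnd ℂ) (qPochInfOmit q m z) = qPochInfOmit q m ((starRingEnd ℂ) z) := by
  simp [qPochInfOmit, conj_qFac, conj_qPochInf hq0 hq1]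

lemma qPochInf_eq_mul_qPochInfOmit (hq0 : 0 < q) (hq1 : q < 1) (m : ℕ) (z : ℂ) :
    qPochInf z q = (1 - (q : ℂ) ^ m * z) * qPochInfOmit q m z := by
  rw [qPochInf_split (norm_ofReal_lt_one hq0 hq1) z (m + 1), qFac_succ, qPochInfOmit]; ring

lemma thetaKernel_circlePt (hq0 : 0 < q) (hq1 : q < 1) (m : ℕ) {θ : ℝ}
    (h : (q : ℂ) ^ m * circlePt θ ≠ 1) :
    thetaKernel q m (circlePt θ) = ((‖qPochInfOmit q m (circlePt θ)‖ ^ 2 : ℝ) : ℂ) := by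
  have h1 : 1 - (q : ℂ) ^ m * circlePt θ ≠ 0 := sub_ne_zero.2 (Ne.symm h)
  have h2 : 1 - (q : ℂ) ^ m * (starRingEnd ℂ) (circlePt θ) ≠ 0 := by
    have := (map_ne_zero (starRingEnd ℂ)).2 h1
    simpa using this
  rw [thetaKernel, div_eq_mul_one_div ((q : ℂ) ^ m), one_div_circlePt,
    qPochInf_eq_mul_qPochInfOmit hq0 hq1 m, qPochInf_eq_mul_qPochInfOmit hq0 hq1 m,
    ← conj_qPochInfOmit hq0 hq1]
  push_cast
  rw [← Complex.mul_conj']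
  field_simp

/-- The kernel agrees almost everywhere on the unit circle with a continuous function; the only
exception is `z = 1` for `m = 0`. -/
lemma thetaKernel_circlePt_ae (hq0 : 0 < q) (hq1 : q < 1) (m : ℕ) :
    (fun θ => thetaKernel q m (circlePt θ)) =ᵐ[volume]
      fun θ => ((‖qPochInfOmit q m (circlePt θ)‖ ^ 2 : ℝ) : ℂ) := by
  filter_upwards [circlePt_ne_one_ae] with θ hθ
  refine thetaKernel_circlePt hq0 hq1 m fun h => hθ ?_
  have h1 := congrArg norm h
  rw [norm_mul, norm_circlePt, mul_one, norm_one, norm_pow, Complex.norm_real,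
    Real.norm_of_nonneg hq0.le] at h1
  have h2 : (q : ℂ) ^ m = 1 := by exact_mod_cast h1
  rwa [h2, one_mul] at h

lemma intervalIntegrable_thetaKernel (hq0 : 0 < q) (hq1 : q < 1) (m : ℕ) :
    IntervalIntegrable (fun θ => thetaKernel q m (circlePt θ)) volume 0 (2 * Real.pi) := by
  have hcont : Continuous fun θ => ((‖qPochInfOmit q m (circlePt θ)‖ ^ 2 : ℝ) : ℂ) := by
    have := (continuous_qPochInfOmit hq0 hq1 m).comp continuous_circlePt
    exact Complex.continuous_ofReal.comp (this.norm.pow 2)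
  exact (hcont.intervalIntegrable _ _).congr_ae
    (ae_restrict_of_ae (thetaKernel_circlePt_ae hq0 hq1 m).symm)

lemma thetaIntegral_eq_ofReal (hq0 : 0 < q) (hq1 : q < 1) (m : ℕ) :
    thetaIntegral q m =
      (((∫ θ in (0 : ℝ)..(2 * Real.pi), ‖qPochInfOmit q m (circlePt θ)‖ ^ 2) / (2 * Real.pi) : ℝ)
        : ℂ) := by
  rw [thetaIntegral, intervalIntegral.integral_congr_ae
    ((thetaKernel_circlePt_ae hq0 hq1 m).mono fun θ h _ => h), intervalIntegral.integral_ofReal]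
  push_cast
  rfl

lemma thetaIntegral_eq_circleIntegral (q : ℝ) (n : ℕ) :
    thetaIntegral q n = ∮ z in C(0, 1), thetaKernel q n z / (2 * Real.pi * Complex.I * z) := by
  rw [thetaIntegral, circleIntegral, ← intervalIntegral.integral_div]
  congr 1; ext θ
  have : circleMap 0 1 θ = circlePt θ := by simp [circleMap, circlePt]
  have h0 := circlePt_ne_zero θ
  rw [deriv_circleMap, this, smul_eq_mul]
  field_simp

end Mean

section Rho
variable {q a : ℝ}

/-- The series for `ρ₀`, by termwise integration of Parseval's identity over the unit circle. -/
theorem IsAlSalamCarlitzSystem.rhoZero_series (hq0 : 0 < q) (hq1 : q < 1) (hqa : q < a)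
    (haq : a * q < 1) {μ : Measure ℝ} {p : ℕ → ℝ[X]} (h : IsAlSalamCarlitzSystem a q μ p) :
    (∀ θ : ℝ, Summable fun k : ℕ => ‖aeval (circlePt θ) (p k)‖ ^ 2) ∧
      IntervalIntegrable (fun θ : ℝ => ∑' k : ℕ, ‖aeval (circlePt θ) (p k)‖ ^ 2)
        volume 0 (2 * Real.pi) ∧
      (Summable fun n : ℕ =>
        thetaIntegral q n * (qPoch (a * q) q n / qPoch q q n) * ((q : ℂ) / a) ^ n) ∧
      (rhoZero p : ℂ) = 1 / (qPochInf (a * q) q * qPochInf q q * qPochInf q q) *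
        ∑' n : ℕ, thetaIntegral q n * (qPoch (a * q) q n / qPoch q q n) * ((q : ℂ) / a) ^ n := by
  have ha : 0 < a := hq0.trans hqa
  have hP := fun θ => h.hasSum_norm_sq hq0 hq1 hqa haq (circlePt θ)
  have heq : ∀ θ, ∑' k : ℕ, ‖aeval (circlePt θ) (p k)‖ ^ 2 =
      ∑' m, parsevalCoeff q a m * ‖qPochInfOmit q m (circlePt θ)‖ ^ 2 := fun θ => (hP θ).tsum_eq
  set B : ℝ := (Real.exp (1 * (1 - q)⁻¹) * Real.exp (1 * (1 - q)⁻¹)) ^ 2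
  have hB : Summable fun m => parsevalCoeff q a m * B :=
    (summable_parsevalCoeff hq0 hq1 hqa haq).mul_right _
  have hle : ∀ m θ, ‖parsevalCoeff q a m * ‖qPochInfOmit q m (circlePt θ)‖ ^ 2‖ ≤
      parsevalCoeff q a m * B := fun m θ => by
    have := parsevalCoeff_mul_norm_sq_le hq0 hq1 ha haq m (circlePt θ)
    rwa [norm_circlePt] at this
  have hcont : ∀ m, Continuous fun θ =>
      parsevalCoeff q a m * ‖qPochInfOmit q m (circlePt θ)‖ ^ 2 := fun m =>
    ((((continuous_qPochInfOmit hq0 hq1 m).comp continuous_circlePt).norm.pow 2).const_mul _)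
  have hint : HasSum (fun m => ∫ θ in (0 : ℝ)..(2 * Real.pi),
      parsevalCoeff q a m * ‖qPochInfOmit q m (circlePt θ)‖ ^ 2)
      (∫ θ in (0 : ℝ)..(2 * Real.pi), ∑' k : ℕ, ‖aeval (circlePt θ) (p k)‖ ^ 2) := by
    refine intervalIntegral.hasSum_integral_of_dominated_convergence
      (fun m _ => parsevalCoeff q a m * B) (fun m => (hcont m).aestronglyMeasurable)
      (fun m => Eventually.of_forall fun θ _ => hle m θ) (Eventually.of_forall fun _ _ => hB)
      intervalIntegrable_const (Eventually.of_forall fun θ _ => ?_)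
    rw [heq]
    exact (hB.of_norm_bounded fun m => hle m θ).hasSum
  have hterm : ∀ m, (((∫ θ in (0 : ℝ)..(2 * Real.pi),
      parsevalCoeff q a m * ‖qPochInfOmit q m (circlePt θ)‖ ^ 2) / (2 * Real.pi) : ℝ) : ℂ) =
      1 / (qPochInf (a * q) q * qPochInf q q * qPochInf q q) *
        (thetaIntegral q m * (qPoch (a * q) q m / qPoch q q m) * ((q : ℂ) / a) ^ m) := by
    intro m
    have hC := qPochInf_mul_tsum_cauchyTerm hq0 hq1 ha haq
    have hC0 : qPochInf ((a : ℂ) * q) q ≠ 0 := by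
      have := left_ne_zero_of_mul_eq_one hC
      rwa [Complex.ofReal_mul] at this
    have hZ : ((∑' s, cauchyTerm q a s : ℝ) : ℂ) = (qPochInf (a * q) q)⁻¹ := by
      rw [Complex.ofReal_mul] at hC
      exact eq_inv_of_mul_eq_one_right hC
    have hN : ((‖qPochInf q q‖ : ℝ) : ℂ) ^ 2 = qPochInf q q * qPochInf q q := by
      rw [← Complex.conj_mul', conj_qPochInf hq0 hq1, Complex.conj_ofReal]
    rw [intervalIntegral.integral_const_mul, mul_div_assoc, Complex.ofReal_mul,
      ← thetaIntegral_eq_ofReal hq0 hq1, parsevalCoeff, qPoch_eq_qFac, qPoch_eq_qFac]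
    push_cast
    rw [← Complex.ofReal_tsum, hZ, hN, ofReal_qFac, ofReal_qFac, Complex.ofReal_mul]
    simp only [div_eq_mul_inv, mul_inv]
    ring
  have hS := Complex.hasSum_ofReal.2 (hint.div_const (2 * Real.pi))
  simp_rw [hterm] at hS
  have hK : 1 / (qPochInf ((a : ℂ) * q) q * qPochInf q q * qPochInf q q) ≠ 0 := by
    have h1 := left_ne_zero_of_mul_eq_one (qPochInf_mul_tsum_cauchyTerm hq0 hq1 ha haq)
    rw [Complex.ofReal_mul] at h1
    have h2 := qPochInf_self_ne_zero hq0 hq1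
    exact one_div_ne_zero (mul_ne_zero (mul_ne_zero h1 h2) h2)
  refine ⟨fun θ => (hP θ).summable, ?_, (summable_mul_left_iff hK).1 hS.summable, ?_⟩
  · simp_rw [heq]
    exact (continuous_tsum hcont hB hle).intervalIntegrable _ _
  · rw [← tsum_mul_left, hS.tsum_eq]; rfl

end Rho

/-! ### The Jacobi triple product -/

section Gauss
variable {R : Type*} [CommRing R]

/-- The Gaussian binomial coefficients, by the `q`-Pascal rule. -/
def gaussBinom (q : R) : ℕ → ℕ → R
  | _, 0 => 1
  | 0, _ + 1 => 0
  | n + 1, k + 1 => q ^ (k + 1) * gaussBinom q n (k + 1) + gaussBinom q n k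

@[simp] lemma gaussBinom_zero_right (q : R) (n : ℕ) : gaussBinom q n 0 = 1 := by
  cases n <;> rfl

lemma gaussBinom_succ_succ (q : R) (n k : ℕ) : gaussBinom q (n + 1) (k + 1) =
    q ^ (k + 1) * gaussBinom q n (k + 1) + gaussBinom q n k := rfl

lemma gaussBinom_eq_zero (q : R) {n k : ℕ} (h : n < k) : gaussBinom q n k = 0 := by
  induction n generalizing k with
  | zero => obtain ⟨k, rfl⟩ := Nat.exists_eq_succ_of_ne_zero h.ne'; rfl
  | succ n ih =>
    obtain ⟨k, rfl⟩ := Nat.exists_eq_succ_of_ne_zero (by omega : k ≠ 0)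
    rw [Nat.succ_eq_add_one, gaussBinom_succ_succ, ih (by omega), ih (by omega)]
    simp

lemma gaussBinom_mul (q : R) (i j : ℕ) :
    gaussBinom q (i + j) j * (qFac q q j * qFac q q i) = qFac q q (i + j) := by
  obtain ⟨s, hs⟩ : ∃ s, s = i + j := ⟨_, rfl⟩
  induction s generalizing i j with
  | zero =>
    obtain ⟨rfl, rfl⟩ : i = 0 ∧ j = 0 := by omega
    simp
  | succ s ih =>
    rcases j with _ | j
    · simp
    · have h1 := ih i j (by omega)
      rw [← add_assoc, gaussBinom_succ_succ, qFac_succ q q (i + j), qFac_succ q q j]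
      rcases i with _ | i
      · rw [gaussBinom_eq_zero q (by omega)]
        simp only [zero_add, qFac_zero, mul_one, mul_zero] at h1 ⊢
        linear_combination (1 - q * q ^ j) * h1
      · have h2 := ih i (j + 1) (by omega)
        rw [show i + (j + 1) = i + 1 + j by ring, qFac_succ q q j] at h2
        rw [qFac_succ q q i] at h1 ⊢
        rw [show i + 1 + j = j + 1 + i by ring] at h1 h2 ⊢
        rw [show j + 1 + i = i + 1 + j by ring, pow_add q (i + 1) j] at *
        linear_combination (q ^ (j + 1)) * (1 - q * q ^ i) * h2 + (1 - q * q ^ j) * h1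

/-- The `q`-binomial theorem of Gauss. -/
lemma qFac_eq_sum (q x : R) (n : ℕ) : qFac x q n =
    ∑ j ∈ Finset.range (n + 1), gaussBinom q n j * ((-1) ^ j * q ^ j.choose 2 * x ^ j) := by
  induction n generalizing x with
  | zero => simp
  | succ n ih =>
    set T : ℕ → R := fun j => gaussBinom q n j * ((-1) ^ j * q ^ j.choose 2 * (x * q) ^ j) with hT
    have h1 : ∑ j ∈ Finset.range (n + 1), T (j + 1) + T 0 =
        ∑ j ∈ Finset.range (n + 1), T j + T (n + 1) := by
      rw [← Finset.sum_range_succ', Finset.sum_range_succ]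
    have h2 : T (n + 1) = 0 := by simp [hT, gaussBinom_eq_zero q (Nat.lt_succ_self n)]
    have h3 : T 0 = 1 := by simp [hT]
    rw [qFac_succ', ih, Finset.sum_range_succ' _ (n + 1)]
    have h4 : ∀ j, gaussBinom q (n + 1) (j + 1) *
        ((-1) ^ (j + 1) * q ^ (j + 1).choose 2 * x ^ (j + 1)) = T (j + 1) - x * T j := by
      intro j
      have : (j + 1).choose 2 = j + j.choose 2 := by
        rw [Nat.choose_succ_succ' j 1, Nat.choose_one_right]
      rw [gaussBinom_succ_succ, hT]
      simp only
      rw [this, pow_add, mul_pow, mul_pow]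
      ring
    simp_rw [h4]
    rw [Finset.sum_sub_distrib, ← Finset.mul_sum]
    simp only [gaussBinom_zero_right, pow_zero, Nat.choose_zero_succ, mul_one]
    change (1 - x) * ∑ j ∈ Finset.range (n + 1), T j = _
    linear_combination -h1 - h2 + h3

end Gauss

section TripleProduct
variable {q : ℝ}

/-- The coefficient `(-1)^k q^{k(k-1)/2}` of Jacobi's theta series. -/
noncomputable def thetaTerm (q : ℝ) (k : ℤ) : ℂ := (-1) ^ k * (q : ℂ) ^ (k * (k - 1) / 2)

lemma two_mul_int_choose (k : ℤ) : 2 * (k * (k - 1) / 2) = k * (k - 1) :=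
  Int.mul_ediv_cancel' (Int.even_mul_pred_self k).two_dvd

lemma two_mul_choose_two (n : ℕ) : 2 * (n.choose 2 : ℤ) = n * (n - 1) := by
  have h := sq_eq_two_mul_choose_add n
  have h' : ((n : ℤ)) ^ 2 = 2 * n.choose 2 + n := by exact_mod_cast h
  linarith

lemma thetaTerm_natCast (q : ℝ) (n : ℕ) : thetaTerm q n = (-1) ^ n * (q : ℂ) ^ n.choose 2 := by
  have : (n : ℤ) * (n - 1) / 2 = (n.choose 2 : ℕ) := by
    have h1 := two_mul_int_choose n
    have h2 := two_mul_choose_two n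
    linarith
  rw [thetaTerm, this, zpow_natCast, zpow_natCast]

lemma thetaTerm_neg (q : ℝ) (n : ℕ) :
    thetaTerm q (-(n : ℤ)) = (-1) ^ n * (q : ℂ) ^ (n + 1).choose 2 := by
  have : -(n : ℤ) * (-(n : ℤ) - 1) / 2 = ((n + 1).choose 2 : ℕ) := by
    have h1 := two_mul_int_choose (-(n : ℤ))
    have h2 := two_mul_choose_two (n + 1)
    push_cast at h2
    linarith
  rw [thetaTerm, this, zpow_natCast, zpow_neg, zpow_natCast, ← inv_pow]
  norm_num

lemma summable_norm_thetaTerm (hq0 : 0 < q) (hq1 : q < 1) {z : ℂ} (hz : z ≠ 0) :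
    Summable fun k : ℤ => ‖thetaTerm q k * z ^ k‖ := by
  have hz0 : 0 < ‖z‖ := norm_pos_iff.2 hz
  have e : ‖(q : ℂ)‖ = q := by simp [abs_of_pos hq0]
  refine Summable.of_nat_of_neg_add_one ?_ ?_
  · refine (summable_pow_choose_mul_pow hq0 hq1 hz0).congr fun n => ?_
    rw [thetaTerm_natCast]
    simp [abs_of_pos hq0]
  · refine ((summable_pow_choose_mul_pow hq0 hq1 (C := q * q * ‖z‖⁻¹) (by positivity)).mul_left
      (q * ‖z‖⁻¹)).congr fun n => ?_
    have h1 : (n + 1 + 1).choose 2 = n + 1 + (n + n.choose 2) := by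
      rw [Nat.choose_succ_succ' (n + 1) 1, Nat.choose_one_right, Nat.choose_succ_succ' n 1,
        Nat.choose_one_right]
    rw [show (-((n : ℤ) + 1)) = -((n + 1 : ℕ) : ℤ) by push_cast; ring, thetaTerm_neg, h1]
    simp only [norm_mul, norm_pow, norm_neg, norm_one, one_pow, one_mul, e, zpow_neg,
      zpow_natCast, norm_inv]
    rw [pow_add, pow_add, pow_add, mul_pow, mul_pow, inv_pow, pow_succ ‖z‖, mul_inv]
    ring

lemma norm_gaussBinom_le (hq0 : 0 < q) (hq1 : q < 1) (i j : ℕ) :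
    ‖gaussBinom (q : ℂ) (i + j) j‖ ≤
      Real.exp (‖(q : ℂ)‖ * (1 - q)⁻¹) * (qExpSum q q * qExpSum q q) := by
  have hj : qFac (q : ℂ) q j ≠ 0 :=
    Finset.prod_ne_zero_iff.2 fun k _ => one_sub_mul_pow_ne_zero hq0 hq1 k
  have hi : qFac (q : ℂ) q i ≠ 0 :=
    Finset.prod_ne_zero_iff.2 fun k _ => one_sub_mul_pow_ne_zero hq0 hq1 k
  rw [(eq_mul_inv_iff_mul_eq₀ (mul_ne_zero hj hi)).2 (gaussBinom_mul (q : ℂ) i j), mul_inv, norm_mul,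
    norm_mul]
  have hE := one_le_qExpSum hq0 hq1 hq0.le hq1
  gcongr
  · simpa using norm_qFac_mul_pow_le hq0 hq1 (q : ℂ) 0 (i + j)
  · exact norm_inv_qFac_self_le hq0 hq1 j
  · exact norm_inv_qFac_self_le hq0 hq1 i

/-- The finite form of the triple product. -/
lemma qFac_mul_qFac_eq_sum (hq0 : 0 < q) {z : ℂ} (hz : z ≠ 0) (N : ℕ) :
    qFac z (q : ℂ) N * qFac ((q : ℂ) / z) q N = ∑ k ∈ Finset.Icc (-(N : ℤ)) N,
      gaussBinom (q : ℂ) (2 * N) (k + N).toNat * (thetaTerm q k * z ^ k) := by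
  have hqC : (q : ℂ) ≠ 0 := by exact_mod_cast hq0.ne'
  have hlow : qFac (z * ((q : ℂ) ^ N)⁻¹) (q : ℂ) N =
      (-z) ^ N * ((q : ℂ) ^ (N + 1).choose 2)⁻¹ * qFac ((q : ℂ) / z) q N := by
    induction N with
    | zero => simp
    | succ N ih =>
      have e1 : z * ((q : ℂ) ^ (N + 1))⁻¹ * q = z * ((q : ℂ) ^ N)⁻¹ := by
        rw [pow_succ]; field_simp
      have e2 : (N + 1 + 1).choose 2 = N + 1 + (N + 1).choose 2 := by
        rw [Nat.choose_succ_succ' (N + 1) 1, Nat.choose_one_right]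
      rw [qFac_succ', e1, ih, qFac_succ, e2, pow_add (q : ℂ) (N + 1), pow_succ (-z), pow_succ (q : ℂ)]
      field_simp
      ring
  have h2 : qFac (z * ((q : ℂ) ^ N)⁻¹) (q : ℂ) (2 * N) =
      (-z) ^ N * ((q : ℂ) ^ (N + 1).choose 2)⁻¹ * (qFac z (q : ℂ) N * qFac ((q : ℂ) / z) q N) := by
    rw [two_mul, qFac_add, hlow, mul_assoc z, inv_mul_cancel₀ (pow_ne_zero _ hqC), mul_one]
    ring
  have hc : (-z) ^ N * ((q : ℂ) ^ (N + 1).choose 2)⁻¹ ≠ 0 :=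
    mul_ne_zero (pow_ne_zero _ (neg_ne_zero.2 hz)) (inv_ne_zero (pow_ne_zero _ hqC))
  refine mul_left_cancel₀ hc (h2.symm.trans ?_)
  rw [qFac_eq_sum, Finset.mul_sum]
  refine Finset.sum_nbij' (fun j => (j : ℤ) - N) (fun k => (k + N).toNat) ?_ ?_ ?_ ?_ ?_
  · intro j hj; simp at hj ⊢; omega
  · intro k hk; simp at hk ⊢; omega
  · intro j hj; simp
  · intro k hk; simp at hk ⊢; omega
  · intro j hj
    have hj' : ((j : ℤ) - N + N).toNat = j := by simp
    rw [hj', thetaTerm]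
    set e := ((j : ℤ) - N) * ((j : ℤ) - N - 1) / 2 with he
    have h3 : (j.choose 2 : ℤ) = -((N + 1).choose 2 : ℕ) + e + N * j := by
      have h4 := two_mul_int_choose ((j : ℤ) - N)
      have h5 := two_mul_choose_two j
      have h6 := two_mul_choose_two (N + 1)
      rw [← he] at h4
      push_cast at h6
      have : 2 * (j.choose 2 : ℤ) = 2 * (-((N + 1).choose 2 : ℕ) + e + N * j) := by
        rw [mul_add, mul_add, h4, h5, mul_neg, h6]; ring
      linarith
    have h7 : (q : ℂ) ^ j.choose 2 =
        ((q : ℂ) ^ (N + 1).choose 2)⁻¹ * (q : ℂ) ^ e * ((q : ℂ) ^ N) ^ j := by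
      rw [← zpow_natCast (q : ℂ) (j.choose 2), h3, zpow_add₀ hqC, zpow_add₀ hqC, zpow_neg,
        zpow_natCast, ← pow_mul, ← zpow_natCast (q : ℂ) (N * j)]
      push_cast; rfl
    have hm : (-1 : ℂ) ≠ 0 := by norm_num
    rw [h7, mul_pow, zpow_sub₀ hz, zpow_sub₀ hm, inv_pow]
    simp only [zpow_natCast]
    have h8 : ((-1 : ℂ) ^ N) * (-1) ^ N = 1 := by rw [← mul_pow]; norm_num
    rw [neg_pow z]
    field_simp

/-- The Jacobi triple product, for the pair `z`, `q / z`. -/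
theorem hasSum_thetaTerm (hq0 : 0 < q) (hq1 : q < 1) {z : ℂ} (hz : z ≠ 0) :
    HasSum (fun k : ℤ => thetaTerm q k * z ^ k)
      (qPochInf q q * (qPochInf z q * qPochInf ((q : ℂ) / z) q)) := by
  have hq := norm_ofReal_lt_one hq0 hq1
  have hQ := qPochInf_self_ne_zero hq0 hq1
  have hs := summable_norm_thetaTerm hq0 hq1 hz
  -- The finite form, extended by zero to all integers, has the right limit in each term.
  set f : ℕ → ℤ → ℂ := fun N k => if k ∈ Finset.Icc (-(N : ℤ)) N then
    gaussBinom (q : ℂ) (2 * N) (k + N).toNat * (thetaTerm q k * z ^ k) else 0 with hf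
  set B := Real.exp (‖(q : ℂ)‖ * (1 - q)⁻¹) * (qExpSum q q * qExpSum q q) with hB
  have hfsum : ∀ N, ∑' k, f N k = qFac z (q : ℂ) N * qFac ((q : ℂ) / z) q N := by
    intro N
    rw [qFac_mul_qFac_eq_sum hq0 hz, tsum_eq_sum (s := Finset.Icc (-(N : ℤ)) N)
      fun k hk => by simp only [hf]; rw [if_neg hk]]
    exact Finset.sum_congr rfl fun k hk => by simp only [hf]; rw [if_pos hk]
  have hlim : ∀ k, Tendsto (fun N => f N k) atTop
      (𝓝 ((qPochInf q q)⁻¹ * (thetaTerm q k * z ^ k))) := by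
    intro k
    have hG : Tendsto (fun N : ℕ => gaussBinom (q : ℂ) (2 * N) (k + N).toNat) atTop
        (𝓝 (qPochInf q q * (qPochInf q q * qPochInf q q)⁻¹)) := by
      have t1 : Tendsto (fun N : ℕ => 2 * N) atTop atTop :=
        tendsto_atTop_mono (fun N => (by omega : N ≤ 2 * N)) tendsto_id
      have t2 : Tendsto (fun N : ℕ => (k + N).toNat) atTop atTop :=
        tendsto_atTop.2 fun b => (eventually_ge_atTop (b + k.natAbs)).mono fun N hN => by omega
      have t3 : Tendsto (fun N : ℕ => (N - k).toNat) atTop atTop :=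
        tendsto_atTop.2 fun b => (eventually_ge_atTop (b + k.natAbs)).mono fun N hN => by omega
      have hT := tendsto_qFac hq (q : ℂ)
      refine ((hT.comp t1).mul (((hT.comp t2).mul (hT.comp t3)).inv₀
        (mul_ne_zero hQ hQ))).congr' ?_
      filter_upwards [eventually_ge_atTop k.natAbs] with N hN
      have e1 : 2 * N = (N - k).toNat + (k + N).toNat := by omega
      have hne : ∀ n, qFac (q : ℂ) q n ≠ 0 := fun n =>
        Finset.prod_ne_zero_iff.2 fun k _ => one_sub_mul_pow_ne_zero hq0 hq1 k
      simp only [Function.comp]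
      rw [e1]
      exact ((eq_mul_inv_iff_mul_eq₀ (mul_ne_zero (hne _) (hne _))).2
        (gaussBinom_mul (q : ℂ) _ _)).symm
    have e2 : qPochInf q q * (qPochInf q q * qPochInf q q)⁻¹ = (qPochInf q q)⁻¹ := by
      field_simp
    rw [e2] at hG
    refine (hG.mul_const (thetaTerm q k * z ^ k)).congr' ?_
    filter_upwards [eventually_ge_atTop k.natAbs] with N hN
    simp only [hf]
    rw [if_pos (by rw [Finset.mem_Icc]; omega)]
  have hbound : ∀ N k, ‖f N k‖ ≤ B * ‖thetaTerm q k * z ^ k‖ := by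
    intro N k
    simp only [hf]
    split_ifs with hk
    · rw [Finset.mem_Icc] at hk
      have e1 : 2 * N = (N - k).toNat + (k + N).toNat := by omega
      rw [norm_mul, e1]
      exact mul_le_mul_of_nonneg_right (norm_gaussBinom_le hq0 hq1 _ _) (norm_nonneg _)
    · have hE := one_le_qExpSum hq0 hq1 hq0.le hq1
      rw [norm_zero]; positivity
  have hT := tendsto_tsum_of_dominated_convergence (hs.mul_left B) hlim
    (Eventually.of_forall hbound)
  simp only [hfsum] at hT
  have h := tendsto_nhds_unique hT ((tendsto_qFac hq z).mul (tendsto_qFac hq ((q : ℂ) / z)))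
  rw [tsum_mul_left] at h
  rw [← h, mul_inv_cancel_left₀ hQ]
  exact hs.of_norm.hasSum

end TripleProduct

/-! ### The integrals `I_n` -/

section ThetaSeries
variable {q : ℝ}

lemma thetaCoeff_eq_sub (q : ℝ) (k : ℤ) : thetaCoeff q k = thetaTerm q k - thetaTerm q (k + 1) := by
  have hm : (-1 : ℂ) ≠ 0 := by norm_num
  rw [thetaCoeff, thetaTerm, thetaTerm, zpow_add₀ hm, zpow_one, add_sub_cancel_right,
    mul_comm (k + 1) k]
  ring

lemma qPochInf_one_div (hq0 : 0 < q) (hq1 : q < 1) (z : ℂ) :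
    qPochInf (1 / z) q = (1 - 1 / z) * qPochInf ((q : ℂ) / z) q := by
  rw [qPochInf_split (norm_ofReal_lt_one hq0 hq1) (1 / z) 1, qFac_succ, qFac_zero, pow_one,
    pow_zero, mul_one, one_mul, one_div, inv_mul_eq_div]

/-- The Jacobi triple product, for the pair `z`, `1 / z`. -/
lemma hasSum_thetaCoeff (hq0 : 0 < q) (hq1 : q < 1) {z : ℂ} (hz : z ≠ 0) :
    HasSum (fun k : ℤ => thetaCoeff q k * z ^ k)
      (qPochInf q q * qPochInf z q * qPochInf (1 / z) q) := by
  have h := hasSum_thetaTerm hq0 hq1 hz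
  have h1 := (((Equiv.addRight (1 : ℤ)).hasSum_iff).2 h).mul_right z⁻¹
  rw [qPochInf_one_div hq0 hq1]
  convert! h.sub h1 using 1
  · ext k
    simp only [Function.comp, Equiv.coe_addRight]
    rw [thetaCoeff_eq_sub, zpow_add₀ hz, zpow_one]
    field_simp
  · ring

lemma summable_norm_thetaCoeff (hq0 : 0 < q) (hq1 : q < 1) {z : ℂ} (hz : z ≠ 0) :
    Summable fun k : ℤ => ‖thetaCoeff q k * z ^ k‖ :=
  (hasSum_thetaCoeff hq0 hq1 hz).summable.norm

lemma thetaCoeff_neg (q : ℝ) (k : ℤ) : thetaCoeff q (-k) = thetaCoeff q k := by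
  have hm : ((-1 : ℂ)) ^ (-k) = (-1) ^ k := by rw [zpow_neg, ← inv_zpow]; norm_num
  rw [thetaCoeff, thetaCoeff, hm, show -k * (-k + 1) = k * (k - 1) by ring,
    show -k * (-k - 1) = k * (k + 1) by ring, add_comm]

/-- The theta function vanishes at the integral powers of `q`. -/
lemma hasSum_thetaTerm_zpow (hq0 : 0 < q) (hq1 : q < 1) (n : ℤ) :
    HasSum (fun k : ℤ => thetaTerm q k * ((q : ℂ) ^ n) ^ k) 0 := by
  have hqC : (q : ℂ) ≠ 0 := by exact_mod_cast hq0.ne'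
  have hq := norm_ofReal_lt_one hq0 hq1
  convert! hasSum_thetaTerm hq0 hq1 (zpow_ne_zero n hqC) using 1
  rcases le_or_gt n 0 with hn | hn
  · obtain ⟨m, rfl⟩ : ∃ m : ℕ, n = -m := ⟨n.natAbs, by omega⟩
    rw [qPochInf_eq_zero hq ((q : ℂ) ^ (-(m : ℤ))) m]
    · simp
    · rw [zpow_neg, zpow_natCast, inv_mul_cancel₀ (pow_ne_zero _ hqC)]
  · obtain ⟨m, rfl⟩ : ∃ m : ℕ, n = m + 1 := ⟨(n - 1).toNat, by omega⟩
    rw [qPochInf_eq_zero hq ((q : ℂ) / (q : ℂ) ^ ((m : ℤ) + 1)) m]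
    · simp
    · rw [zpow_add₀ hqC, zpow_one, zpow_natCast]
      field_simp

end ThetaSeries

section CircleMeans
variable {q : ℝ}

lemma circleMean_zpow (k : ℤ) :
    (∫ θ in (0 : ℝ)..(2 * Real.pi), circlePt θ ^ k) / (2 * Real.pi) = if k = 0 then 1 else 0 := by
  have hpi : (Real.pi : ℂ) ≠ 0 := by exact_mod_cast Real.pi_ne_zero
  split_ifs with hk
  · subst hk
    simp only [zpow_zero, intervalIntegral.integral_const, sub_zero]
    simp [hpi]
  · have hc : (k : ℂ) * Complex.I ≠ 0 := mul_ne_zero (by exact_mod_cast hk) Complex.I_ne_zero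
    have e : ∀ θ : ℝ, circlePt θ ^ k = Complex.exp ((k : ℂ) * Complex.I * θ) := by
      intro θ
      rw [circlePt, ← Complex.exp_int_mul]
      congr 1; ring
    simp_rw [e]
    rw [integral_exp_mul_complex hc]
    have h1 : Complex.exp ((k : ℂ) * Complex.I * ((2 * Real.pi : ℝ) : ℂ)) = 1 := by
      rw [show (k : ℂ) * Complex.I * ((2 * Real.pi : ℝ) : ℂ) = k * (2 * Real.pi * Complex.I) by
        push_cast; ring]
      exact Complex.exp_int_mul_two_pi_mul_I k
    rw [h1]
    simp

lemma continuous_circlePt_zpow (k : ℤ) : Continuous fun θ => circlePt θ ^ k :=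
  continuous_circlePt.zpow₀ k fun θ => Or.inl (circlePt_ne_zero θ)

/-- Termwise integration over the unit circle. -/
lemma hasSum_circleMean {ι : Type*} [Countable ι] {F : ι → ℝ → ℂ} {b : ι → ℝ} {g : ℝ → ℂ}
    (hF : ∀ i, Continuous (F i)) (hb : Summable b) (hle : ∀ i θ, ‖F i θ‖ ≤ b i)
    (hg : ∀ᵐ θ ∂(volume : Measure ℝ), HasSum (fun i => F i θ) (g θ)) :
    HasSum (fun i => (∫ θ in (0 : ℝ)..(2 * Real.pi), F i θ) / (2 * Real.pi))
      ((∫ θ in (0 : ℝ)..(2 * Real.pi), g θ) / (2 * Real.pi)) :=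
  (intervalIntegral.hasSum_integral_of_dominated_convergence (fun i _ => b i)
    (fun i => (hF i).aestronglyMeasurable) (fun i => Eventually.of_forall fun θ _ => hle i θ)
    (Eventually.of_forall fun _ _ => hb) intervalIntegrable_const
    (hg.mono fun _ h _ => h)).div_const _

/-- The Laurent expansion of the Poisson kernel. -/
lemma hasSum_poisson {r : ℂ} (hr : ‖r‖ < 1) {z : ℂ} (hz : ‖z‖ = 1) :
    HasSum (fun j : ℤ => r ^ j.natAbs * z ^ j) ((1 - r ^ 2) / ((1 - r * z) * (1 - r / z))) := by
  have hz0 : z ≠ 0 := norm_ne_zero_iff.1 (by rw [hz]; exact one_ne_zero)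
  have n1 : ‖r * z‖ < 1 := by rwa [norm_mul, hz, mul_one]
  have n2 : ‖r / z‖ < 1 := by rwa [norm_div, hz, div_one]
  have h1 : 1 - r * z ≠ 0 := sub_ne_zero.2 fun h => by rw [← h] at n1; simp at n1
  have h2 : 1 - r / z ≠ 0 := sub_ne_zero.2 fun h => by rw [← h] at n2; simp at n2
  have s1 := hasSum_geometric_of_norm_lt_one n1
  have s2 := (hasSum_geometric_of_norm_lt_one n2).mul_left (r / z)
  have h := HasSum.of_nat_of_neg_add_one (f := fun j : ℤ => r ^ j.natAbs * z ^ j)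
    (s1.congr_fun fun n => by simp [mul_pow])
    (s2.congr_fun fun n => by
      rw [show (-((n : ℤ) + 1)) = -((n + 1 : ℕ) : ℤ) by push_cast; ring, Int.natAbs_neg,
        Int.natAbs_natCast, zpow_neg, zpow_natCast, ← pow_succ', div_pow, div_eq_mul_inv])
  convert! h using 1
  have h2' : z - r ≠ 0 := by
    intro h0
    exact h2 (by rw [← sub_eq_zero.1 h0, div_self hz0, sub_self])
  field_simp
  ring

lemma summable_norm_pow_natAbs {r : ℂ} (hr : ‖r‖ < 1) : Summable fun j : ℤ => ‖r‖ ^ j.natAbs := by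
  simpa using (hasSum_poisson hr (z := 1) (by simp)).summable.norm

lemma circleMean_zpow_mul_poisson {r : ℂ} (hr : ‖r‖ < 1) (k : ℤ) :
    (∫ θ in (0 : ℝ)..(2 * Real.pi), circlePt θ ^ k *
      ((1 - r ^ 2) / ((1 - r * circlePt θ) * (1 - r / circlePt θ)))) / (2 * Real.pi) =
      r ^ k.natAbs := by
  have hs := summable_norm_pow_natAbs hr
  have h := hasSum_circleMean (F := fun (j : ℤ) θ => r ^ j.natAbs * circlePt θ ^ (k + j))
    (fun j => (continuous_circlePt_zpow _).const_mul _) hs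
    (fun j θ => by simp [norm_circlePt])
    (Eventually.of_forall fun θ => by
      refine ((hasSum_poisson hr (norm_circlePt θ)).mul_left (circlePt θ ^ k)).congr_fun fun j => ?_
      rw [zpow_add₀ (circlePt_ne_zero θ)]; ring)
  refine h.unique ?_
  have e : ∀ j : ℤ, (∫ θ in (0 : ℝ)..(2 * Real.pi), r ^ j.natAbs * circlePt θ ^ (k + j)) /
      (2 * Real.pi) = if j = -k then r ^ k.natAbs else 0 := by
    intro j
    rw [intervalIntegral.integral_const_mul, mul_div_assoc, circleMean_zpow]
    by_cases hj : j = -k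
    · subst hj; simp
    · rw [if_neg (by omega), if_neg hj, mul_zero]
  simp_rw [e]
  exact hasSum_ite_eq _ _

end CircleMeans

section ThetaIntegrals
variable {q : ℝ}

lemma norm_pow_lt_one (hq0 : 0 < q) (hq1 : q < 1) {n : ℕ} (hn : n ≠ 0) : ‖(q : ℂ) ^ n‖ < 1 := by
  rw [norm_pow]; exact pow_lt_one₀ (norm_nonneg _) (norm_ofReal_lt_one hq0 hq1) hn

lemma one_sub_sq_ne_zero (hq0 : 0 < q) (hq1 : q < 1) {n : ℕ} (hn : n ≠ 0) :
    1 - ((q : ℂ) ^ n) ^ 2 ≠ 0 := by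
  have h := norm_pow_lt_one hq0 hq1 (n := n * 2) (by omega)
  rw [pow_mul] at h
  exact sub_ne_zero.2 fun h0 => by rw [← h0] at h; simp at h

/-- `I_n` for `n ≥ 1`, by integrating the triple product termwise against the Poisson kernel. -/
lemma hasSum_thetaCoeff_mul_natAbs (hq0 : 0 < q) (hq1 : q < 1) {n : ℕ} (hn : n ≠ 0) :
    HasSum (fun k : ℤ => thetaCoeff q k * ((q : ℂ) ^ n) ^ k.natAbs)
      (qPochInf q q * (1 - ((q : ℂ) ^ n) ^ 2) * thetaIntegral q n) := by
  set r : ℂ := (q : ℂ) ^ n with hr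
  have hr1 : ‖r‖ < 1 := norm_pow_lt_one hq0 hq1 hn
  set P : ℝ → ℂ := fun θ => (1 - r ^ 2) / ((1 - r * circlePt θ) * (1 - r / circlePt θ)) with hP
  have n1 : ∀ θ, 1 - r * circlePt θ ≠ 0 := fun θ => sub_ne_zero.2 fun h => by
    have := congrArg norm h
    rw [norm_one, norm_mul, norm_circlePt, mul_one] at this
    linarith
  have n2 : ∀ θ, 1 - r / circlePt θ ≠ 0 := fun θ => sub_ne_zero.2 fun h => by
    have := congrArg norm h
    rw [norm_one, norm_div, norm_circlePt, div_one] at this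
    linarith
  have hs := summable_norm_pow_natAbs hr1
  have hPc : Continuous P :=
    continuous_const.div ((continuous_const.sub (continuous_circlePt.const_mul r)).mul
      (continuous_const.sub (continuous_const.div continuous_circlePt circlePt_ne_zero)))
      fun θ => mul_ne_zero (n1 θ) (n2 θ)
  have hPle : ∀ θ, ‖P θ‖ ≤ ∑' j : ℤ, ‖r‖ ^ j.natAbs := fun θ => by
    simp only [hP]
    rw [← (hasSum_poisson hr1 (norm_circlePt θ)).tsum_eq]
    refine tsum_of_norm_bounded hs.hasSum fun j => ?_
    simp [norm_circlePt]
  have hcs : Summable fun k : ℤ => ‖thetaCoeff q k‖ := by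
    simpa using summable_norm_thetaCoeff hq0 hq1 one_ne_zero
  have h := hasSum_circleMean (F := fun (k : ℤ) θ => thetaCoeff q k * (circlePt θ ^ k * P θ))
    (g := fun θ => qPochInf q q * (1 - r ^ 2) * thetaKernel q n (circlePt θ))
    (fun k => ((continuous_circlePt_zpow k).mul hPc).const_mul _) (hcs.mul_right _)
    (fun k θ => by
      rw [norm_mul, norm_mul, norm_zpow, norm_circlePt, one_zpow, one_mul]
      exact mul_le_mul_of_nonneg_left (hPle θ) (norm_nonneg _))
    (Eventually.of_forall fun θ => by
      have h1 := (hasSum_thetaCoeff hq0 hq1 (circlePt_ne_zero θ)).mul_right (P θ)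
      convert! h1 using 1
      · ext k; ring
      · rw [thetaKernel, hP, ← hr]
        simp only [div_eq_mul_inv]
        ring)
  rw [intervalIntegral.integral_const_mul, mul_div_assoc] at h
  refine h.congr_fun fun k => ?_
  rw [intervalIntegral.integral_const_mul, mul_div_assoc, circleMean_zpow_mul_poisson hr1]

/-- The bilateral series for `I_n`, minus the theta function at its zero `q^n`, leaves only the
terms with negative index. -/
lemma hasSum_thetaIntegral (hq0 : 0 < q) (hq1 : q < 1) {n : ℕ} (hn : n ≠ 0) :
    HasSum (fun k : ℕ => thetaCoeff q (k + 1) *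
      ((q : ℂ) ^ (n * (k + 1)) - ((q : ℂ) ^ (n * (k + 1)))⁻¹))
      (qPochInf q q * (1 - ((q : ℂ) ^ n) ^ 2) * thetaIntegral q n) := by
  have hqC : (q : ℂ) ≠ 0 := by exact_mod_cast hq0.ne'
  have hq := norm_ofReal_lt_one hq0 hq1
  have h1 := hasSum_thetaCoeff hq0 hq1 (pow_ne_zero n hqC)
  -- The triple product vanishes at `z = q^n`, through the factor `(1 / z; q)_∞`.
  rw [qPochInf_eq_zero hq (1 / (q : ℂ) ^ n) n (one_div_mul_cancel (pow_ne_zero n hqC)),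
    mul_zero] at h1
  have h2 := (hasSum_thetaCoeff_mul_natAbs hq0 hq1 hn).sub h1
  rw [sub_zero] at h2
  have hinj : Function.Injective fun k : ℕ => -((k : ℤ) + 1) := fun i j h => by
    simp at h; exact h
  refine ((hinj.hasSum_iff ?_).2 h2).congr_fun fun k => ?_
  · intro k hk
    have hk0 : 0 ≤ k := by
      by_contra hneg
      exact hk ⟨(-k - 1).toNat, by simp only; omega⟩
    obtain ⟨m, rfl⟩ := Int.eq_ofNat_of_zero_le hk0
    simp
  · simp only [Function.comp]
    rw [thetaCoeff_neg, Int.natAbs_neg, zpow_neg, pow_mul,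
      show ((k : ℤ) + 1).natAbs = k + 1 by omega,
      show ((k : ℤ) + 1) = ((k + 1 : ℕ) : ℤ) by push_cast; rfl, zpow_natCast]
    push_cast
    ring

/-- `I_0`: pairing the terms of the theta series with the exponents `-k` and `k + 1` makes it
divisible by `1 - z`, with a quotient whose constant term is visible. -/
lemma hasSum_thetaIntegral_zero (hq0 : 0 < q) (hq1 : q < 1) :
    HasSum (fun k : ℕ => (-1 : ℂ) ^ k * (q : ℂ) ^ (k + 1).choose 2)
      (qPochInf q q * thetaIntegral q 0) := by
  set t : ℕ → ℂ := fun k => (-1 : ℂ) ^ k * (q : ℂ) ^ (k + 1).choose 2 with ht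
  set S : ℕ → ℝ → ℂ := fun k θ =>
    ∑ i ∈ Finset.range (2 * k + 1), circlePt θ ^ ((i : ℤ) - k) with hS
  have hb : Summable fun k : ℕ => ‖t k‖ * (2 * k + 1) := by
    have h1 := (summable_pow_choose_mul_pow hq0 hq1 (C := q * 3) (by positivity))
    refine Summable.of_nonneg_of_le (fun k => by positivity) (fun k => ?_) h1
    have e1 : (k + 1).choose 2 = k + k.choose 2 := by
      rw [Nat.choose_succ_succ' k 1, Nat.choose_one_right]
    have e2 : ‖t k‖ = q ^ k.choose 2 * q ^ k := by
      simp only [ht, norm_mul, norm_pow, norm_neg, norm_one, one_pow, one_mul, e1, pow_add,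
        Complex.norm_real, Real.norm_of_nonneg hq0.le]
      ring
    have e3 : (2 * k + 1 : ℝ) ≤ 3 ^ k := by
      have := one_add_mul_le_pow (a := (2 : ℝ)) (by norm_num) k
      norm_num at this
      linarith
    rw [e2, mul_pow, ← mul_assoc]
    gcongr
  have h := hasSum_circleMean (F := fun k θ => t k * S k θ)
    (g := fun θ => qPochInf q q * thetaKernel q 0 (circlePt θ))
    (fun k => (continuous_finsetSum _ fun i _ => continuous_circlePt_zpow _).const_mul _) hb
    (fun k θ => by
      rw [norm_mul]
      refine mul_le_mul_of_nonneg_left ?_ (norm_nonneg _)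
      refine (norm_sum_le _ _).trans (le_of_eq ?_)
      simp [norm_circlePt]) ?_
  · rw [intervalIntegral.integral_const_mul, mul_div_assoc] at h
    refine h.congr_fun fun k => ?_
    rw [intervalIntegral.integral_const_mul, mul_div_assoc,
      intervalIntegral.integral_finsetSum
        fun i _ => (continuous_circlePt_zpow _).intervalIntegrable _ _, Finset.sum_div]
    simp_rw [circleMean_zpow]
    rw [Finset.sum_eq_single k (fun i _ hi => if_neg (by omega))
      (fun hk => absurd (Finset.mem_range.2 (by omega)) hk)]
    simp
  · filter_upwards [circlePt_ne_one_ae] with θ hθ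
    have hz := circlePt_ne_zero θ
    set z := circlePt θ with hzdef
    have h1 : 1 - z ≠ 0 := sub_ne_zero.2 (Ne.symm hθ)
    have h2 : 1 - 1 / z ≠ 0 := by
      intro h0
      apply h1
      rw [sub_eq_zero, eq_div_iff hz, one_mul] at h0
      rw [h0, sub_self]
    have hT := hasSum_thetaTerm hq0 hq1 hz
    have hsm := hT.summable
    have hpair : HasSum (fun k : ℕ => t k * (z ^ (-(k : ℤ)) - z ^ ((k : ℤ) + 1)))
        (qPochInf q q * (qPochInf z q * qPochInf ((q : ℂ) / z) q)) := by
      have hneg : Function.Injective fun k : ℕ => -(k : ℤ) := fun i j h => by simpa using h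
      have hpos : Function.Injective fun k : ℕ => (k : ℤ) + 1 := fun i j h => by simpa using h
      have s1 := hsm.comp_injective hneg
      have s2 := hsm.comp_injective hpos
      have hs := HasSum.of_nat_of_neg_add_one (f := fun k : ℤ => thetaTerm q (-k) * z ^ (-k))
        s1.hasSum ((s2.congr fun k => by simp [Function.comp]).hasSum)
      have hu := hs.unique ((Equiv.neg ℤ).hasSum_iff.2 hT)
      rw [← hu]
      refine (s1.hasSum.add (s2.congr fun k => by simp [Function.comp]).hasSum).congr_fun fun k => ?_
      simp only [Function.comp, neg_neg]
      rw [thetaTerm_neg, show ((k : ℤ) + 1) = ((k + 1 : ℕ) : ℤ) by push_cast; rfl,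
        thetaTerm_natCast, pow_succ (-1 : ℂ)]
      simp only [ht]
      ring
    have hfin := hpair.div_const (1 - z)
    convert! hfin using 1
    · ext k
      rw [eq_div_iff h1, mul_assoc]
      congr 1
      have hgeom := mul_neg_geom_sum z (2 * k + 1)
      have : S k θ = z ^ (-(k : ℤ)) * ∑ i ∈ Finset.range (2 * k + 1), z ^ i := by
        simp only [hS]
        rw [Finset.mul_sum]
        refine Finset.sum_congr rfl fun i _ => ?_
        rw [← zpow_natCast z i, ← zpow_add₀ hz, ← hzdef]
        congr 1; ring
      rw [this, mul_assoc, mul_comm _ (1 - z), hgeom, mul_sub, mul_one, ← zpow_natCast z,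
        ← zpow_add₀ hz]
      congr 2
      push_cast; ring
    · rw [thetaKernel, qPochInf_one_div hq0 hq1]
      simp only [pow_zero, one_mul]
      field_simp

end ThetaIntegrals

/-! ### One-sided theta series -/

section OneSided
variable {q : ℝ}

lemma summable_one_sided (hq0 : 0 < q) (hq1 : q < 1) (n : ℤ) :
    Summable fun k : ℕ => (-1 : ℂ) ^ k * (q : ℂ) ^ (n * k) * (q : ℂ) ^ k.choose 2 := by
  refine ((hasSum_thetaTerm_zpow hq0 hq1 n).summable.comp_injective
    Nat.cast_injective).congr fun k => ?_
  simp only [Function.comp]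
  rw [thetaTerm_natCast, zpow_mul]
  ring

lemma summable_one_sided_neg (hq0 : 0 < q) (hq1 : q < 1) (n : ℤ) :
    Summable fun k : ℕ =>
      (-1 : ℂ) ^ (k + 1) * (q : ℂ) ^ (-n * (k + 1)) * (q : ℂ) ^ (k + 2).choose 2 := by
  have hinj : Function.Injective fun k : ℕ => -((k : ℤ) + 1) := fun i j h => by simpa using h
  refine ((hasSum_thetaTerm_zpow hq0 hq1 n).summable.comp_injective hinj).congr fun k => ?_
  simp only [Function.comp]
  rw [show -((k : ℤ) + 1) = -((k + 1 : ℕ) : ℤ) by push_cast; ring, thetaTerm_neg, ← zpow_mul,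
    show n * -((k + 1 : ℕ) : ℤ) = -n * (k + 1) by push_cast; ring]
  ring

/-- The two halves of the theta series at its zero `q^n` cancel. -/
lemma tsum_one_sided (hq0 : 0 < q) (hq1 : q < 1) (n : ℤ) :
    ∑' k : ℕ, (-1 : ℂ) ^ k * (q : ℂ) ^ (n * k) * (q : ℂ) ^ k.choose 2 =
      -∑' k : ℕ,
        (-1 : ℂ) ^ (k + 1) * (q : ℂ) ^ (-n * (k + 1)) * (q : ℂ) ^ (k + 2).choose 2 := by
  have h := HasSum.of_nat_of_neg_add_one (f := fun k : ℤ => thetaTerm q k * ((q : ℂ) ^ n) ^ k)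
    ((summable_one_sided hq0 hq1 n).hasSum.congr_fun fun k => by
      rw [thetaTerm_natCast, zpow_mul]; ring)
    ((summable_one_sided_neg hq0 hq1 n).hasSum.congr_fun fun k => by
      rw [show -((k : ℤ) + 1) = -((k + 1 : ℕ) : ℤ) by push_cast; ring, thetaTerm_neg, ← zpow_mul,
        show n * -((k + 1 : ℕ) : ℤ) = -n * (k + 1) by push_cast; ring]
      ring)
  exact eq_neg_of_add_eq_zero_left (h.unique (hasSum_thetaTerm_zpow hq0 hq1 n))

/-- The half series with the exponents `C(k, 2)`, antisymmetrised in `n`. -/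
lemma hasSum_antisymm_choose (hq0 : 0 < q) (hq1 : q < 1) (n : ℕ) :
    HasSum (fun k : ℕ => (-1 : ℂ) ^ (k + 1) * (q : ℂ) ^ (k + 1).choose 2 *
        ((q : ℂ) ^ (n * (k + 1)) - ((q : ℂ) ^ (n * (k + 1)))⁻¹))
      (∑' k : ℕ, (-1 : ℂ) ^ k * (q : ℂ) ^ ((n : ℤ) * k) * (q : ℂ) ^ k.choose 2 -
        ∑' k : ℕ, (-1 : ℂ) ^ k * (q : ℂ) ^ (-(n : ℤ) * k) * (q : ℂ) ^ k.choose 2) := by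
  have h := (summable_one_sided hq0 hq1 n).hasSum.sub (summable_one_sided hq0 hq1 (-n)).hasSum
  rw [← hasSum_nat_add_iff' 1] at h
  simp only [Finset.range_one, Finset.sum_singleton, Nat.cast_zero, mul_zero, sub_self,
    sub_zero] at h
  refine h.congr_fun fun k => ?_
  rw [neg_mul, zpow_neg, show (n : ℤ) * ((k + 1 : ℕ) : ℤ) = ((n * (k + 1) : ℕ) : ℤ) by push_cast; ring,
    zpow_natCast]
  ring

/-- The same value, from the half series with the exponents `C(k + 1, 2)`. -/
lemma hasSum_antisymm_choose_succ (hq0 : 0 < q) (hq1 : q < 1) (n : ℕ) :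
    HasSum (fun k : ℕ => (-1 : ℂ) ^ (k + 1) * (q : ℂ) ^ (k + 2).choose 2 *
        ((q : ℂ) ^ (n * (k + 1)) - ((q : ℂ) ^ (n * (k + 1)))⁻¹))
      (∑' k : ℕ, (-1 : ℂ) ^ k * (q : ℂ) ^ ((n : ℤ) * k) * (q : ℂ) ^ k.choose 2 -
        ∑' k : ℕ, (-1 : ℂ) ^ k * (q : ℂ) ^ (-(n : ℤ) * k) * (q : ℂ) ^ k.choose 2) := by
  rw [tsum_one_sided hq0 hq1 n, tsum_one_sided hq0 hq1 (-n), neg_sub_neg]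
  refine ((summable_one_sided_neg hq0 hq1 (-n)).hasSum.sub
    (summable_one_sided_neg hq0 hq1 n).hasSum).congr_fun fun k => ?_
  rw [neg_neg, neg_mul, zpow_neg,
    show (n : ℤ) * ((k : ℤ) + 1) = ((n * (k + 1) : ℕ) : ℤ) by push_cast; ring, zpow_natCast]
  ring

lemma thetaCoeff_add_one (q : ℝ) (k : ℕ) : thetaCoeff q (k + 1) =
    (-1) ^ (k + 1) * (q : ℂ) ^ (k + 1).choose 2 + (-1) ^ (k + 1) * (q : ℂ) ^ (k + 2).choose 2 := by
  rw [thetaCoeff_eq_sub, show ((k : ℤ) + 1) = ((k + 1 : ℕ) : ℤ) by push_cast; rfl,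
    show (((k + 1 : ℕ) : ℤ) + 1) = ((k + 2 : ℕ) : ℤ) by push_cast; ring, thetaTerm_natCast,
    thetaTerm_natCast]
  ring

/-- The simplified theta series for `I_n`. -/
lemma hasSum_thetaIntegral_simplified (hq0 : 0 < q) (hq1 : q < 1) (n : ℕ) :
    HasSum (fun k : ℕ => (-1 : ℂ) ^ (k + 1) * (q : ℂ) ^ (k + 1).choose 2 *
        ((q : ℂ) ^ (n * (k + 1)) - ((q : ℂ) ^ (n * (k + 1)))⁻¹))
      (qPochInf q q * (1 - (q : ℂ) ^ (2 * n)) * thetaIntegral q n / 2) := by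
  have h1 := hasSum_antisymm_choose hq0 hq1 n
  rcases eq_or_ne n 0 with rfl | hn
  · simp
  · have h2 := (h1.add (hasSum_antisymm_choose_succ hq0 hq1 n)).unique
      ((hasSum_thetaIntegral hq0 hq1 hn).congr_fun fun k => by rw [thetaCoeff_add_one]; ring)
    have h3 : (q : ℂ) ^ (2 * n) = ((q : ℂ) ^ n) ^ 2 := by rw [mul_comm, pow_mul]
    rw [h3, ← h2, add_self_div_two]
    exact h1

lemma one_sub_pow_two_mul_ne_zero (hq0 : 0 < q) (hq1 : q < 1) {n : ℕ} (hn : n ≠ 0) :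
    1 - (q : ℂ) ^ (2 * n) ≠ 0 := by
  rw [mul_comm, pow_mul]; exact one_sub_sq_ne_zero hq0 hq1 hn

lemma pow_sub_inv_eq_sin {τ : ℂ} (hτ : (q : ℂ) = Complex.exp (-(Complex.I * τ))) (m : ℕ) :
    (q : ℂ) ^ m - ((q : ℂ) ^ m)⁻¹ = -(2 * Complex.I) * Complex.sin (m * τ) := by
  have h1 : (q : ℂ) ^ m = Complex.exp (-(m * τ) * Complex.I) := by
    rw [hτ, ← Complex.exp_nat_mul]; congr 1; ring
  have h2 : ((q : ℂ) ^ m)⁻¹ = Complex.exp (m * τ * Complex.I) := by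
    rw [h1, ← Complex.exp_neg]; congr 1; ring
  rw [h2, h1, Complex.sin]
  linear_combination (Complex.exp (-(m * τ) * Complex.I) - Complex.exp (m * τ * Complex.I)) *
    Complex.I_sq

end OneSided

theorem mainTheorem4 (q a : ℝ) (hq0 : 0 < q) (hq1 : q < 1) (hqa : q < a) (haq : a < 1 / q) :
    -- the orthonormal system exists
    (∃ (μ : Measure ℝ) (p : ℕ → ℝ[X]), IsAlSalamCarlitzSystem a q μ p) ∧
    -- the series for `ρ₀`
    (∀ (μ : Measure ℝ) (p : ℕ → ℝ[X]), IsAlSalamCarlitzSystem a q μ p →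
      (∀ θ : ℝ, Summable fun k : ℕ => ‖aeval (circlePt θ) (p k)‖ ^ 2) ∧
      IntervalIntegrable (fun θ : ℝ => ∑' k : ℕ, ‖aeval (circlePt θ) (p k)‖ ^ 2)
        volume 0 (2 * Real.pi) ∧
      (Summable fun n : ℕ =>
        thetaIntegral q n * (qPoch (a * q) q n / qPoch q q n) * ((q : ℂ) / a) ^ n) ∧
      (rhoZero p : ℂ) = 1 / (qPochInf (a * q) q * qPochInf q q * qPochInf q q) *
        ∑' n : ℕ, thetaIntegral q n * (qPoch (a * q) q n / qPoch q q n) * ((q : ℂ) / a) ^ n) ∧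
    -- the integrals `I_n` as contour integrals
    (∀ n : ℕ, IntervalIntegrable (fun θ : ℝ => thetaKernel q n (circlePt θ))
        volume 0 (2 * Real.pi) ∧
      thetaIntegral q n = ∮ z in C(0, 1), thetaKernel q n z / (2 * Real.pi * Complex.I * z)) ∧
    -- the Jacobi triple product, and the symmetry of its coefficients
    (∀ z : ℂ, z ≠ 0 → HasSum (fun k : ℤ => thetaCoeff q k * z ^ k)
      (qPochInf q q * qPochInf z q * qPochInf (1 / z) q)) ∧
    (∀ k : ℤ, thetaCoeff q k = thetaCoeff q (-k)) ∧
    -- `I_0`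
    (Summable fun k : ℕ => (-1 : ℂ) ^ k * (q : ℂ) ^ (k * (k + 1) / 2)) ∧
    thetaIntegral q 0 =
      1 / qPochInf q q * ∑' k : ℕ, (-1 : ℂ) ^ k * (q : ℂ) ^ (k * (k + 1) / 2) ∧
    -- `I_n` for `n ≥ 1` through the coefficients `c_k`, `k ≥ 1`
    (∀ n : ℕ, 1 ≤ n →
      (Summable fun k : ℕ => thetaCoeff q (k + 1) *
        ((q : ℂ) ^ (n * (k + 1)) - ((q : ℂ) ^ (n * (k + 1)))⁻¹)) ∧
      thetaIntegral q n = 1 / ((1 - (q : ℂ) ^ (2 * n)) * qPochInf q q) *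
        ∑' k : ℕ, thetaCoeff q (k + 1) *
          ((q : ℂ) ^ (n * (k + 1)) - ((q : ℂ) ^ (n * (k + 1)))⁻¹)) ∧
    -- the vanishing bilateral theta sum and its one-sided form, for integers `n`
    (∀ n : ℤ,
      HasSum (fun k : ℤ => (-1 : ℂ) ^ k * (q : ℂ) ^ (n * k) * (q : ℂ) ^ (k * (k - 1) / 2)) 0 ∧
      (Summable fun k : ℕ => (-1 : ℂ) ^ k * (q : ℂ) ^ (n * k) * (q : ℂ) ^ k.choose 2) ∧
      (Summable fun k : ℕ =>
        (-1 : ℂ) ^ (k + 1) * (q : ℂ) ^ (-n * (k + 1)) * (q : ℂ) ^ (k + 2).choose 2) ∧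
      ∑' k : ℕ, (-1 : ℂ) ^ k * (q : ℂ) ^ (n * k) * (q : ℂ) ^ k.choose 2 =
        -∑' k : ℕ,
          (-1 : ℂ) ^ (k + 1) * (q : ℂ) ^ (-n * (k + 1)) * (q : ℂ) ^ (k + 2).choose 2) ∧
    -- the simplified theta sum for `I_n`, summed over `k + 1 ≥ 1`
    (∀ n : ℕ,
      (Summable fun k : ℕ => (-1 : ℂ) ^ (k + 1) * (q : ℂ) ^ (k + 1).choose 2 *
        ((q : ℂ) ^ (n * (k + 1)) - ((q : ℂ) ^ (n * (k + 1)))⁻¹)) ∧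
      qPochInf q q * (1 - (q : ℂ) ^ (2 * n)) * thetaIntegral q n =
        2 * ∑' k : ℕ, (-1 : ℂ) ^ (k + 1) * (q : ℂ) ^ (k + 1).choose 2 *
          ((q : ℂ) ^ (n * (k + 1)) - ((q : ℂ) ^ (n * (k + 1)))⁻¹)) ∧
    -- the trigonometric form, with `q = e^{-iτ}`
    (∀ n : ℕ, 1 ≤ n → ∀ τ : ℂ, (q : ℂ) = Complex.exp (-(Complex.I * τ)) →
      Complex.sin (n * τ) ≠ 0 ∧
      (Summable fun k : ℕ => (-1 : ℂ) ^ k * (q : ℂ) ^ (k + 1).choose 2 *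
        (Complex.sin (n * (k + 1) * τ) / Complex.sin (n * τ))) ∧
      thetaIntegral q n = 2 * ((q : ℂ) ^ n)⁻¹ / qPochInf q q *
        ∑' k : ℕ, (-1 : ℂ) ^ k * (q : ℂ) ^ (k + 1).choose 2 *
          (Complex.sin (n * (k + 1) * τ) / Complex.sin (n * τ))) := by

  have ha : 0 < a := hq0.trans hqa
  have haq' : a * q < 1 := (lt_div_iff₀ hq0).1 haq
  have hqC : (q : ℂ) ≠ 0 := by exact_mod_cast hq0.ne'
  have hQ := qPochInf_self_ne_zero hq0 hq1
  refine ⟨exists_isAlSalamCarlitzSystem hq0 hq1 ha haq',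
    fun μ p h => h.rhoZero_series hq0 hq1 hqa haq',
    fun n => ⟨intervalIntegrable_thetaKernel hq0 hq1 n, thetaIntegral_eq_circleIntegral q n⟩,
    fun z hz => hasSum_thetaCoeff hq0 hq1 hz, fun k => (thetaCoeff_neg q k).symm, ?_, ?_, ?_, ?_, ?_,
    ?_⟩
  · refine (hasSum_thetaIntegral_zero hq0 hq1).summable.congr fun k => ?_
    rw [Nat.choose_two_right, Nat.add_sub_cancel, mul_comm (k + 1) k]
  · have h : ∀ k : ℕ, (-1 : ℂ) ^ k * (q : ℂ) ^ (k * (k + 1) / 2) =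
        (-1) ^ k * (q : ℂ) ^ (k + 1).choose 2 := fun k => by
      rw [Nat.choose_two_right, Nat.add_sub_cancel, mul_comm (k + 1) k]
    simp_rw [h]
    rw [(hasSum_thetaIntegral_zero hq0 hq1).tsum_eq, one_div, inv_mul_cancel_left₀ hQ]
  · intro n hn
    have hn0 : n ≠ 0 := by omega
    have h := hasSum_thetaIntegral hq0 hq1 hn0
    refine ⟨h.summable, ?_⟩
    have h1 := one_sub_pow_two_mul_ne_zero hq0 hq1 hn0
    rw [h.tsum_eq, ← pow_mul, mul_comm n 2]
    field_simp
  · intro n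
    refine ⟨(hasSum_thetaTerm_zpow hq0 hq1 n).congr_fun fun k => ?_,
      summable_one_sided hq0 hq1 n, summable_one_sided_neg hq0 hq1 n, tsum_one_sided hq0 hq1 n⟩
    rw [thetaTerm, zpow_mul]; ring
  · intro n
    have h := hasSum_thetaIntegral_simplified hq0 hq1 n
    refine ⟨h.summable, ?_⟩
    rw [h.tsum_eq]; ring
  · intro n hn τ hτ
    have hn0 : n ≠ 0 := by omega
    have hone := one_sub_pow_two_mul_ne_zero hq0 hq1 hn0
    have hqn : (q : ℂ) ^ n ≠ 0 := pow_ne_zero n hqC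
    have hsn := pow_sub_inv_eq_sin hτ n
    have hsin : Complex.sin (n * τ) ≠ 0 := by
      intro h0
      rw [h0, mul_zero, sub_eq_zero] at hsn
      refine hone ?_
      rw [two_mul, pow_add]
      nth_rewrite 2 [hsn]
      rw [mul_inv_cancel₀ hqn, sub_self]
    have hterm : ∀ k : ℕ, (-1 : ℂ) ^ k * (q : ℂ) ^ (k + 1).choose 2 *
        (Complex.sin (n * (k + 1) * τ) / Complex.sin (n * τ)) =
        (2 * Complex.I * Complex.sin (n * τ))⁻¹ *
          ((-1 : ℂ) ^ (k + 1) * (q : ℂ) ^ (k + 1).choose 2 *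
            ((q : ℂ) ^ (n * (k + 1)) - ((q : ℂ) ^ (n * (k + 1)))⁻¹)) := by
      intro k
      rw [pow_sub_inv_eq_sin hτ]
      have hI := Complex.I_ne_zero
      push_cast
      field_simp
      ring
    have h := (hasSum_thetaIntegral_simplified hq0 hq1 n).mul_left
      (2 * Complex.I * Complex.sin (n * τ))⁻¹
    refine ⟨hsin, h.summable.congr fun k => (hterm k).symm, ?_⟩
    simp_rw [hterm]
    rw [h.tsum_eq]
    have h2 : 2 * Complex.I * Complex.sin (n * τ) = ((q : ℂ) ^ n)⁻¹ * (1 - (q : ℂ) ^ (2 * n)) := by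
      have e : ((q : ℂ) ^ n)⁻¹ * (1 - (q : ℂ) ^ (2 * n)) = -((q : ℂ) ^ n - ((q : ℂ) ^ n)⁻¹) := by
        rw [two_mul, pow_add]; field_simp; ring
      rw [e, hsn]; ring
    rw [h2]
    field_simp
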